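/- All graphs are finite and simple. A graph $G$ is perfect if $\chi(H)=\omega(H)$ for every induced subgraph $H$ of $G$ (chromatic number equals maximum clique size). A pure pair in $G$ is a pair $A,B$ of disjoint subsets of $V(G)$ such that either every vertex of $A$ is adjacent to every vertex of $B$, or no vertex of $A$ is adjacent to a vertex of $B$. For every real $c>0$ there exists $N$ such that for every integer $n\ge N$, every $n$-vertex perfect graph $G$ has a pure pair $A,B$ with $|A|,|B|\ge n^{1-c}$. Consequently Fox's conjecture holds: there is a function $\delta:\mathbb{N}\to\mathbb{R}$ with $\delta(n)\to 0$ as $n\to\infty$ such that, for all sufficiently large $n$, every $n$-vertex perfect graph $G$ has a pure pair $A,B$ with $|A|,|B|\ge n^{1-\delta(n)}$. -/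

import Mathlib

open Filter Topology

universe u

namespace SimpleGraph

/-- A graph is perfect if, in each of its induced subgraphs (the graph itself included), the
chromatic number equals the largest size of a clique. -/
def IsPerfect {V : Type*} (G : SimpleGraph V) : Prop :=
  ∀ X : Set V, (G.induce X).chromaticNumber = ((G.induce X).cliqueNum : ℕ∞)

/-- Every vertex of `A` is adjacent to every vertex of `B`. -/
def CompleteTo {V : Type*} (G : SimpleGraph V) (A B : Finset V) : Prop :=
  ∀ a ∈ A, ∀ b ∈ B, G.Adj a b

/-- No vertex of `A` has a neighbour in `B`. -/
def AnticompleteTo {V : Type*} (G : SimpleGraph V) (A B : Finset V) : Prop :=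
  ∀ a ∈ A, ∀ b ∈ B, ¬ G.Adj a b

/-- A pure pair: two disjoint vertex sets that are complete or anticomplete to each other. -/
def IsPurePair {V : Type*} (G : SimpleGraph V) (A B : Finset V) : Prop :=
  Disjoint A B ∧ (G.CompleteTo A B ∨ G.AnticompleteTo A B)

end SimpleGraph

/-!
If every induced subgraph `H` of `G` satisfies `|H| ≤ ω(H) α(H)`, as Lovász showed for perfect `G`,
then neither `G` nor its complement has an odd hole. In particular neither contains a pentagon, so
by Rödl's theorem there is a set `W` of linear size in which `G` or its complement is as sparse as
desired; complements exchange complete and anticomplete pairs, so suppose `G` is sparse in `W`.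

Suppose any two disjoint `m`-sets in `W` are joined by an edge, where `m ≈ n ^ (1 - c)`, and let
`D ≈ n ^ (c / 2)` and `K ≥ 2 / c`, so that `m ≤ D ^ K`. Expansion by factors of `D` lets a suitable
vertex reach `m` vertices in `K` steps through any given large sets. Grow connected sets
`T 0 ⊆ T 1 ⊆ ⋯` whose closed neighbourhoods have prescribed sizes, let `Z` be the set of vertices
outside all these neighbourhoods, and let `x` be a vertex attached to `T 0` that reaches `m`
vertices of `Z`. A vertex of the `j`-th block, attached to `T (j + 1)` but not to `T j`, is joined
to `x` both through `Z` and through `T (j + 1)`, and two induced paths closed up by the same third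
one to form holes have lengths of the same parity. By pigeonhole, many blocks contain many vertices
at the same distance from `x` through `Z`. Start from such a vertex `y`, and let `q` precede it on a
shortest path from `x`. By parity `q` stays adjacent to all the vertices reached from `y` by moving
through these blocks one after another, and by expansion these outnumber the maximum degree.
-/

namespace PerfectGraph

open SimpleGraph

section Berge

variable {V W : Type*} {G : SimpleGraph V}

/-- `G` has no odd hole: no induced cycle of odd length at least five. -/
def OddHoleFree (G : SimpleGraph V) : Prop :=
  ∀ l, 5 ≤ l → Odd l → ¬ cycleGraph l ⊴ G

/-- Berge graphs: neither `G` nor its complement has an odd hole. By the strong perfect graph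
theorem these are exactly the perfect graphs. -/
def IsBerge (G : SimpleGraph V) : Prop :=
  OddHoleFree G ∧ OddHoleFree Gᶜ

lemma OddHoleFree.of_isIndContained {H : SimpleGraph W} (hG : OddHoleFree G) (hHG : H ⊴ G) :
    OddHoleFree H :=
  fun l hl hodd hcycle ↦ hG l hl hodd (hcycle.trans hHG)

lemma cliqueNum_le_of_isIndContained [Finite V] {H : SimpleGraph W} (hHG : H ⊴ G) :
    H.cliqueNum ≤ G.cliqueNum := by
  obtain ⟨f⟩ := hHG
  obtain ⟨Q, hQ⟩ := H.exists_isNClique_cliqueNum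
  have hmap : G.IsClique (Q.map f.toEmbedding) := by
    rw [Finset.coe_map]
    rintro _ ⟨a, ha, rfl⟩ _ ⟨b, hb, rfl⟩ hab
    exact f.map_rel_iff.mpr (hQ.isClique ha hb fun h ↦ hab (h ▸ rfl))
  calc H.cliqueNum = (Q.map f.toEmbedding).card := by rw [Finset.card_map, hQ.card_eq]
    _ ≤ G.cliqueNum := IsClique.card_le_cliqueNum (tc := hmap)

lemma card_le_mul_indepNum_of_colorable [Fintype V] {n : ℕ} (h : G.Colorable n) :
    Fintype.card V ≤ n * G.indepNum := by
  classical
  obtain ⟨C⟩ := h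
  calc Fintype.card V = ∑ i : Fin n, (Finset.univ.filter (C · = i)).card := by
        rw [← Finset.card_univ]
        exact Finset.card_eq_sum_card_fiberwise fun v _ ↦ Finset.mem_univ (C v)
    _ ≤ ∑ _i : Fin n, G.indepNum := by
        refine Finset.sum_le_sum fun i _ ↦ IsIndepSet.card_le_indepNum ?_
        simpa [Coloring.colorClass] using C.isIndepSet_colorClass i
    _ = n * G.indepNum := by simp

lemma card_le_cliqueNum_mul_indepNum [Fintype W] {H : SimpleGraph W} (hG : G.IsPerfect)
    (hHG : H ⊴ G) : Fintype.card W ≤ H.cliqueNum * H.indepNum := by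
  obtain ⟨f⟩ := hHG
  let e : H ≃g G.induce (Set.range f) := f.isoInduceRange
  have hchrom : H.chromaticNumber ≤ H.cliqueNum := by
    rw [chromaticNumber_congr e, hG, Nat.cast_le]
    exact cliqueNum_le_of_isIndContained ⟨e.symm.toEmbedding⟩
  exact card_le_mul_indepNum_of_colorable (chromaticNumber_le_iff_colorable.mp hchrom)

lemma cycleGraph_adj_iff_val {l : ℕ} (hl : 2 ≤ l) {i j : Fin l} :
    (cycleGraph l).Adj i j ↔ j.val = i.val + 1 ∨ i.val = j.val + 1 ∨
      (i.val = 0 ∧ j.val + 1 = l) ∨ (j.val = 0 ∧ i.val + 1 = l) := by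
  rw [cycleGraph_adj', Fin.val_sub, Fin.val_sub]
  rcases lt_trichotomy i.val j.val with h | h | h
  · rw [Nat.mod_eq_of_lt (by lia), Nat.mod_eq_sub_mod (by lia), Nat.mod_eq_of_lt (by lia)]
    lia
  · simp only [h, Nat.sub_add_cancel j.is_le', Nat.mod_self]
    lia
  · rw [Nat.mod_eq_sub_mod (by lia), Nat.mod_eq_of_lt (by lia), Nat.mod_eq_of_lt (by lia)]
    lia

lemma cliqueNum_cycleGraph_le_two {l : ℕ} (hl : 4 ≤ l) : (cycleGraph l).cliqueNum ≤ 2 := by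
  obtain ⟨Q, hQ⟩ := (cycleGraph l).exists_isNClique_cliqueNum
  rw [← hQ.card_eq]
  by_contra! hcard
  obtain ⟨a, ha, b, hb, c, hc, hab, hac, hbc⟩ := Finset.two_lt_card.mp hcard
  have hab' := (cycleGraph_adj_iff_val (by lia)).mp (hQ.isClique ha hb hab)
  have hac' := (cycleGraph_adj_iff_val (by lia)).mp (hQ.isClique ha hc hac)
  have hbc' := (cycleGraph_adj_iff_val (by lia)).mp (hQ.isClique hb hc hbc)
  rw [← Fin.val_ne_iff] at hab hac hbc
  lia

lemma two_mul_indepNum_cycleGraph_le {l : ℕ} (hl : 2 ≤ l) : 2 * (cycleGraph l).indepNum ≤ l := by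
  obtain ⟨n, rfl⟩ := Nat.exists_eq_add_of_le' hl
  obtain ⟨I, hI⟩ := (cycleGraph (n + 2)).exists_isNIndepSet_indepNum
  have hdisj : Disjoint I (I.map (Equiv.addRight 1).toEmbedding) := by
    rw [Finset.disjoint_right]
    rintro _ hv hv'
    obtain ⟨u, hu, rfl⟩ := Finset.mem_map.mp hv
    have hadj : (cycleGraph (n + 2)).Adj u (u + 1) := by simp [cycleGraph_adj]
    exact hI.isIndepSet hu hv' hadj.ne hadj
  calc 2 * (cycleGraph (n + 2)).indepNum
      = (I.disjUnion _ hdisj).card := by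
        rw [Finset.card_disjUnion, Finset.card_map, hI.card_eq, two_mul]
    _ ≤ n + 2 := Finset.card_le_univ _ |>.trans_eq (Fintype.card_fin _)

lemma cliqueNum_mul_indepNum_cycleGraph_lt {l : ℕ} (hl : 4 ≤ l) (hodd : Odd l) :
    (cycleGraph l).cliqueNum * (cycleGraph l).indepNum < l := by
  have hle : (cycleGraph l).cliqueNum * (cycleGraph l).indepNum ≤ 2 * (cycleGraph l).indepNum :=
    Nat.mul_le_mul_right _ (cliqueNum_cycleGraph_le_two hl)
  have hindep := two_mul_indepNum_cycleGraph_le (l := l) (by lia)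
  obtain ⟨k, hk⟩ := hodd
  lia

/-- The easy half of the strong perfect graph theorem, from Lovász' inequality `|H| ≤ ω(H) α(H)`
for induced subgraphs `H`, which odd holes and their complements violate. -/
theorem isBerge_of_isPerfect (hG : G.IsPerfect) : IsBerge G := by
  refine ⟨fun l hl hodd hole ↦ ?_, fun l hl hodd antihole ↦ ?_⟩
  · have hLovasz := card_le_cliqueNum_mul_indepNum hG hole
    rw [Fintype.card_fin] at hLovasz
    exact (cliqueNum_mul_indepNum_cycleGraph_lt (by lia) hodd).not_ge hLovasz
  · rw [← compl_isIndContained_compl, compl_compl] at antihole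
    have hLovasz := card_le_cliqueNum_mul_indepNum hG antihole
    rw [Fintype.card_fin, cliqueNum_compl, indepNum_compl, mul_comm] at hLovasz
    exact (cliqueNum_mul_indepNum_cycleGraph_lt (by lia) hodd).not_ge hLovasz

end Berge

section Walks

variable {V : Type*} {G : SimpleGraph V} {S : Set V} {x y z : V} {l : ℕ}

/-- All vertices of the walk `p`, except possibly its first and last one, lie in `S`. -/
def InteriorIn (p : G.Walk x y) (S : Set V) : Prop :=
  ∀ i, 0 < i → i < p.length → p.getVert i ∈ S

/-- The vertices of `p` are distinct and induce a path in `G`. -/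
def IsInducedPath (p : G.Walk x y) : Prop :=
  ∀ i j, i < j → j ≤ p.length →
    p.getVert i ≠ p.getVert j ∧ (G.Adj (p.getVert i) (p.getVert j) ↔ j = i + 1)

/-- The lengths of the walks from `x` to `y` with interior in `S`. The least element of this set,
expressed with `IsLeast`, is the distance from `x` to `y` through `S`. -/
def lengthsThrough (G : SimpleGraph V) (S : Set V) (x y : V) : Set ℕ :=
  {a | ∃ p : G.Walk x y, p.length = a ∧ InteriorIn p S}

lemma InteriorIn.concat {p : G.Walk x y} (hp : InteriorIn p S) (hy : p.length ≠ 0 → y ∈ S)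
    (h : G.Adj y z) : InteriorIn (p.concat h) S := by
  intro i hi hilt
  rw [Walk.length_concat] at hilt
  rw [Walk.concat_eq_append, Walk.getVert_append']
  rcases (Nat.lt_succ_iff.mp hilt).lt_or_eq with hi' | rfl
  · rw [if_pos hi'.le]
    exact hp i hi hi'
  · rw [if_pos le_rfl, Walk.getVert_length]
    exact hy hi.ne'

lemma one_mem_lengthsThrough (h : G.Adj x y) : 1 ∈ lengthsThrough G S x y :=
  ⟨h.toWalk, rfl, fun i hi hi' ↦ absurd hi' (by simp; lia)⟩

lemma succ_mem_lengthsThrough (hl : l ∈ lengthsThrough G S x y) (hy : l ≠ 0 → y ∈ S)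
    (h : G.Adj y z) : l + 1 ∈ lengthsThrough G S x z := by
  obtain ⟨p, rfl, hp⟩ := hl
  exact ⟨p.concat h, Walk.length_concat p h, hp.concat hy h⟩

lemma InteriorIn.mem_lengthsThrough_getVert {p : G.Walk x y} (hp : InteriorIn p S) {i : ℕ}
    (hi : i ≤ p.length) : i ∈ lengthsThrough G S x (p.getVert i) := by
  refine ⟨p.take i, by simp [hi], fun j hj hji ↦ ?_⟩
  rw [Walk.take_length, lt_min_iff] at hji
  rw [Walk.take_getVert, min_eq_right hji.1.le]
  exact hp j hj hji.2

/-- Replacing the stretch of `p` between its `i`-th and `j`-th vertices by `q`. -/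
lemma InteriorIn.shortcut {p : G.Walk x y} (hp : InteriorIn p S) {i j : ℕ} (hij : i < j)
    (hj : j ≤ p.length) {q : G.Walk (p.getVert i) (p.getVert j)} (hq : q.length ≤ 1) :
    i + q.length + (p.length - j) ∈ lengthsThrough G S x y := by
  refine ⟨((p.take i).append q).append (p.drop j), ?_, fun k hk hklt ↦ ?_⟩
  · simp [(hij.le.trans hj)]
  simp only [Walk.length_append, Walk.take_length, Walk.drop_length,
    min_eq_left (hij.le.trans hj)] at hklt
  simp only [Walk.getVert_append, Walk.length_append, Walk.take_length, Walk.take_getVert,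
    Walk.drop_getVert, min_eq_left (hij.le.trans hj)]
  split_ifs with hkq hki
  · rw [min_eq_right hki.le]
    exact hp k hk (by lia)
  · obtain rfl : k = i := by lia
    rw [Nat.sub_self, Walk.getVert_zero]
    exact hp k hk (by lia)
  · exact hp _ (by lia) (by lia)

lemma isInducedPath_of_forall_le {p : G.Walk x y} (hp : InteriorIn p S)
    (hmin : p.length ∈ lowerBounds (lengthsThrough G S x y)) : IsInducedPath p := by
  intro i j hij hj
  have hchord (q : G.Walk (p.getVert i) (p.getVert j)) (hq : q.length ≤ 1) : j ≤ i + q.length := by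
    have := hmin (hp.shortcut hij hj hq)
    lia
  refine ⟨fun heq ↦ ?_, fun hadj ↦ ?_, ?_⟩
  · have := hchord (Walk.nil.copy rfl heq) (by simp)
    simp only [Walk.length_copy, Walk.length_nil] at this
    lia
  · have := hchord hadj.toWalk (by simp)
    simp only [Walk.length_cons, Walk.length_nil] at this
    lia
  · rintro rfl
    exact p.adj_getVert_succ hj

lemma exists_isInducedPath_of_isLeast (hl : IsLeast (lengthsThrough G S x y) l) :
    ∃ p : G.Walk x y, p.length = l ∧ InteriorIn p S ∧ IsInducedPath p := by
  obtain ⟨⟨p, rfl, hp⟩, hmin⟩ := hl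
  exact ⟨p, rfl, hp, isInducedPath_of_forall_le hp hmin⟩

lemma IsInducedPath.concat {p : G.Walk x y} (hp : IsInducedPath p) (h : G.Adj y z)
    (hz : ∀ i < p.length, p.getVert i ≠ z ∧ ¬ G.Adj (p.getVert i) z) :
    IsInducedPath (p.concat h) := by
  have hinit {i : ℕ} (hi : i ≤ p.length) : (p.concat h).getVert i = p.getVert i := by
    rw [Walk.concat_eq_append, Walk.getVert_append', if_pos hi]
  intro i j hij hj
  rw [Walk.length_concat] at hj
  rcases hj.lt_or_eq with hj' | rfl
  · rw [hinit (by lia), hinit (by lia)]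
    exact hp i j hij (by lia)
  rw [hinit (by lia), Walk.getVert_of_length_le _ (Walk.length_concat p h).le]
  rcases (Nat.lt_succ_iff.mp hij).lt_or_eq with hi | rfl
  · exact ⟨(hz i hi).1, iff_of_false (hz i hi).2 (by lia)⟩
  · rw [Walk.getVert_length]
    exact ⟨h.ne, iff_of_true h rfl⟩

lemma two_le_length {p : G.Walk x y} (hxy : x ≠ y) (hadj : ¬ G.Adj x y) : 2 ≤ p.length := by
  by_contra! hlt
  interval_cases hp : p.length
  · exact hxy (Walk.eq_of_length_eq_zero hp)
  · exact hadj (Walk.adj_of_length_eq_one hp)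

lemma ne_and_not_adj_of_two_le (hl : l ∈ lowerBounds (lengthsThrough G S x y)) (hl2 : 2 ≤ l) :
    x ≠ y ∧ ¬ G.Adj x y := by
  refine ⟨?_, fun h ↦ ?_⟩
  · rintro rfl
    have := hl ⟨Walk.nil, Walk.length_nil, fun i _ hi ↦ absurd hi (Nat.not_lt_zero i)⟩
    lia
  · have := hl (one_mem_lengthsThrough h)
    lia

lemma InteriorIn.mono {T : Set V} {p : G.Walk x y} (hp : InteriorIn p S) (hST : S ⊆ T) :
    InteriorIn p T :=
  fun i hi hi' ↦ hST (hp i hi hi')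

/-- The walk `x … q y y'` prolonging a shortest walk `x … q y` through `S`. -/
lemma exists_isInducedPath_succ {y' q : V} (hly : l + 1 ∈ lowerBounds (lengthsThrough G S x y))
    (hly' : l + 1 ∈ lowerBounds (lengthsThrough G S x y')) (hl : l ≠ 0)
    (hlq : l ∈ lengthsThrough G S x q) (hqS : q ∈ S) (hy'S : y' ∉ S) (hqy : G.Adj q y)
    (hyy' : G.Adj y y') (hqy' : ¬ G.Adj q y') :
    ∃ p : G.Walk x y', p.length = l + 2 ∧ InteriorIn p (insert y S) ∧ IsInducedPath p := by
  obtain ⟨p₀, rfl, hp₀⟩ := hlq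
  have hp : InteriorIn (p₀.concat hqy) S := hp₀.concat (fun _ ↦ hqS) hqy
  have hlen : (p₀.concat hqy).length = p₀.length + 1 := Walk.length_concat p₀ hqy
  have hq : (p₀.concat hqy).getVert p₀.length = q := by
    rw [Walk.concat_eq_append, Walk.getVert_append', if_pos le_rfl, Walk.getVert_length]
  have hpath : IsInducedPath (p₀.concat hqy) := isInducedPath_of_forall_le hp (hlen ▸ hly)
  generalize p₀.concat hqy = p at hp hlen hq hpath
  refine ⟨p.concat hyy', by rw [Walk.length_concat, hlen],
    (hp.mono (Set.subset_insert y S)).concat (fun _ ↦ Set.mem_insert y S) hyy',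
    hpath.concat hyy' fun i hi ↦ ?_⟩
  rcases Nat.eq_zero_or_pos i with rfl | hi0
  · rw [Walk.getVert_zero]
    exact ne_and_not_adj_of_two_le hly' (by lia)
  have hiS : p.getVert i ∈ S := hp i hi0 hi
  refine ⟨fun h ↦ hy'S (h ▸ hiS), fun hadj ↦ ?_⟩
  have hlast : p₀.length + 1 ≤ i + 1 :=
    hly' (succ_mem_lengthsThrough (hp.mem_lengthsThrough_getVert hi.le) (fun _ ↦ hiS) hadj)
  obtain rfl : i = p₀.length := by lia
  exact hqy' (hq ▸ hadj)

lemma cycleGraph_isIndContained_of_forall_lt (hl : 2 ≤ l) {f : ℕ → V}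
    (hf : ∀ i j, i < j → j < l →
      f i ≠ f j ∧ (G.Adj (f i) (f j) ↔ j = i + 1 ∨ (i = 0 ∧ j + 1 = l))) :
    cycleGraph l ⊴ G := by
  have hinj : Function.Injective fun i : Fin l ↦ f i := fun i j hij ↦ by
    rcases lt_trichotomy i j with h | h | h
    · exact absurd hij (hf i j h j.is_lt).1
    · exact h
    · exact absurd hij.symm (hf j i h i.is_lt).1
  refine ⟨⟨⟨fun i ↦ f i, hinj⟩, fun {i j} ↦ ?_⟩⟩
  change G.Adj (f i) (f j) ↔ (cycleGraph l).Adj i j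
  rw [cycleGraph_adj_iff_val hl]
  rcases lt_trichotomy i j with h | rfl | h
  · rw [(hf i j h j.is_lt).2]
    lia
  · simp only [SimpleGraph.irrefl, false_iff]
    lia
  · rw [G.adj_comm, (hf j i h i.is_lt).2]
    lia

lemma cycleGraph_isIndContained_of_isInducedPath {p : G.Walk x y} {r : G.Walk y x}
    (hp : IsInducedPath p) (hr : IsInducedPath r) (hp2 : 2 ≤ p.length) (hr2 : 2 ≤ r.length)
    (hpr : ∀ i j, 0 < i → i < p.length → 0 < j → j < r.length →
      p.getVert i ≠ r.getVert j ∧ ¬ G.Adj (p.getVert i) (r.getVert j)) :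
    cycleGraph (p.length + r.length) ⊴ G := by
  have hx : p.getVert 0 = r.getVert r.length := by rw [Walk.getVert_zero, Walk.getVert_length]
  have hy : p.getVert p.length = r.getVert 0 := by rw [Walk.getVert_zero, Walk.getVert_length]
  refine cycleGraph_isIndContained_of_forall_lt (by lia) (f := (p.append r).getVert) ?_
  intro i j hij hj
  simp only [Walk.getVert_append]
  split_ifs with hi hj'
  · rw [(hp i j hij hj'.le).2]
    exact ⟨(hp i j hij hj'.le).1, by lia⟩
  · rcases Nat.eq_zero_or_pos i with rfl | hi0
    · have hrj := hr (j - p.length) r.length (by lia) le_rfl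
      rw [hx, G.adj_comm, hrj.2]
      exact ⟨hrj.1.symm, by lia⟩
    rcases (not_lt.mp hj').eq_or_lt with rfl | hj0
    · rw [Nat.sub_self, ← hy, (hp i _ hi le_rfl).2]
      exact ⟨(hp i _ hi le_rfl).1, by lia⟩
    · obtain ⟨hne, hnadj⟩ := hpr i (j - p.length) hi0 hi (by lia) (by lia)
      exact ⟨hne, iff_of_false hnadj (by lia)⟩
  · lia
  · have hrij := hr (i - p.length) (j - p.length) (by lia) (by lia)
    rw [hrij.2]
    exact ⟨hrij.1, by lia⟩

lemma OddHoleFree.even_length_add (hG : OddHoleFree G) {p : G.Walk x y} {r : G.Walk y x}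
    (hp : IsInducedPath p) (hr : IsInducedPath r) (hp2 : 2 ≤ p.length) (hr2 : 2 ≤ r.length)
    (hpr : ∀ i j, 0 < i → i < p.length → 0 < j → j < r.length →
      p.getVert i ≠ r.getVert j ∧ ¬ G.Adj (p.getVert i) (r.getVert j)) :
    Even (p.length + r.length) := by
  by_contra hodd
  rw [Nat.not_even_iff_odd] at hodd
  exact hG _ (by obtain ⟨k, hk⟩ := hodd; lia) hodd
    (cycleGraph_isIndContained_of_isInducedPath hp hr hp2 hr2 hpr)

lemma lengthsThrough_nonempty {s t : V} (hS : (G.induce S).Preconnected) (hs : s ∈ S) (ht : t ∈ S)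
    (hxs : G.Adj x s) (hty : G.Adj t y) : (lengthsThrough G S x y).Nonempty := by
  obtain ⟨p⟩ := hS ⟨s, hs⟩ ⟨t, ht⟩
  let p' : G.Walk s t := p.map (Embedding.induce S).toHom
  have hp' (i : ℕ) : p'.getVert i ∈ S := by
    have heq : p'.getVert i = p.getVert i := Walk.getVert_map _ p i
    exact heq ▸ (p.getVert i).2
  refine ⟨_, (Walk.cons hxs p').concat hty, rfl, InteriorIn.concat (fun i hi _ ↦ ?_) (fun _ ↦ ht) _⟩
  rw [Walk.getVert_cons _ _ hi.ne']
  exact hp' _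

end Walks

section Neighbourhoods

variable {V : Type*} [Fintype V] [DecidableEq V] {G : SimpleGraph V} [DecidableRel G.Adj]
  {S T Z : Finset V} {v x : V}

/-- The vertices with at least one neighbour in `S`; vertices of `S` may be among them. -/
def nbhd (G : SimpleGraph V) [DecidableRel G.Adj] (S : Finset V) : Finset V :=
  S.biUnion fun v ↦ G.neighborFinset v

/-- The closed neighbourhood `N[T]`: the vertices of `T` together with their neighbours. -/
def closedNbhd (G : SimpleGraph V) [DecidableRel G.Adj] (T : Finset V) : Finset V :=
  T ∪ nbhd G T

lemma mem_nbhd : v ∈ nbhd G S ↔ ∃ u ∈ S, G.Adj u v := by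
  simp [nbhd]

lemma mem_closedNbhd : v ∈ closedNbhd G T ↔ v ∈ T ∨ ∃ u ∈ T, G.Adj u v := by
  rw [closedNbhd, Finset.mem_union, mem_nbhd]

lemma nbhd_union (S T : Finset V) : nbhd G (S ∪ T) = nbhd G S ∪ nbhd G T :=
  Finset.union_biUnion

lemma nbhd_mono (h : S ⊆ T) : nbhd G S ⊆ nbhd G T :=
  Finset.biUnion_subset_biUnion_of_subset_left _ h

lemma closedNbhd_mono (h : S ⊆ T) : closedNbhd G S ⊆ closedNbhd G T :=
  Finset.union_subset_union h (nbhd_mono h)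

lemma exists_isInducedPath_through (hT : (G.induce (T : Set V)).Preconnected) {y : V}
    (hx : x ∈ nbhd G T) (hy : y ∈ nbhd G T) :
    ∃ r : G.Walk x y, InteriorIn r (T : Set V) ∧ IsInducedPath r := by
  obtain ⟨s, hs, hsx⟩ := mem_nbhd.mp hx
  obtain ⟨t, ht, hty⟩ := mem_nbhd.mp hy
  have hne := lengthsThrough_nonempty hT (Finset.mem_coe.mpr hs) (Finset.mem_coe.mpr ht)
    hsx.symm hty
  obtain ⟨r, -, hr⟩ := exists_isInducedPath_of_isLeast
    (⟨Nat.sInf_mem hne, fun _ ↦ Nat.sInf_le⟩ : IsLeast (lengthsThrough G T x y) _)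
  exact ⟨r, hr⟩

/-- Closing the two paths by a path from `y` to `x` through `T` gives two holes. -/
lemma OddHoleFree.even_length_add_length (hG : OddHoleFree G) {y : V}
    (hT : (G.induce (T : Set V)).Preconnected) (hx : x ∈ nbhd G T) (hy : y ∈ nbhd G T)
    {p p' : G.Walk x y} (hp : IsInducedPath p) (hp' : IsInducedPath p') (hp2 : 2 ≤ p.length)
    (hp2' : 2 ≤ p'.length) (hpT : InteriorIn p {v | v ∉ closedNbhd G T})
    (hpT' : InteriorIn p' {v | v ∉ closedNbhd G T}) : Even (p.length + p'.length) := by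
  obtain ⟨r, hrT, hr⟩ := exists_isInducedPath_through hT hy hx
  have hxy : x ≠ y ∧ ¬ G.Adj x y := by
    have hends := hp 0 p.length (by lia) le_rfl
    rw [Walk.getVert_zero, Walk.getVert_length] at hends
    exact ⟨hends.1, fun h ↦ absurd (hends.2.mp h) (by lia)⟩
  have hr2 : 2 ≤ r.length := two_le_length hxy.1.symm fun h ↦ hxy.2 h.symm
  have heven {w : G.Walk x y} (hw : IsInducedPath w) (hw2 : 2 ≤ w.length)
      (hwT : InteriorIn w {v | v ∉ closedNbhd G T}) : Even (w.length + r.length) := by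
    refine hG.even_length_add hw hr hw2 hr2 fun i j hi hi' hj hj' ↦ ⟨fun h ↦ ?_, fun h ↦ ?_⟩
    · exact hwT i hi hi' (mem_closedNbhd.mpr (.inl (h ▸ hrT j hj hj')))
    · exact hwT i hi hi' (mem_closedNbhd.mpr (.inr ⟨_, hrT j hj hj', h.symm⟩))
  have h₁ := heven hp hp2 hpT
  have h₂ := heven hp' hp2' hpT'
  rw [Nat.even_iff] at h₁ h₂ ⊢
  lia

/-- If `q` were not adjacent to `y'`, then a shortest walk from `x` to `y'` through `Z` and the
walk `x … q y y'`, longer by one, would contradict `OddHoleFree.even_length_add_length`. -/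
lemma OddHoleFree.adj_of_isLeast (hG : OddHoleFree G) {l : ℕ} {y y' q : V}
    (hT : (G.induce (T : Set V)).Preconnected) (hZT : Disjoint Z (closedNbhd G T))
    (hx : x ∈ nbhd G T) (hy : y ∉ closedNbhd G T) (hy' : y' ∈ nbhd G T) (hl : l ≠ 0)
    (hly : IsLeast (lengthsThrough G Z x y) (l + 1))
    (hly' : IsLeast (lengthsThrough G Z x y') (l + 1)) (hlq : l ∈ lengthsThrough G Z x q)
    (hqZ : q ∈ Z) (hqy : G.Adj q y) (hyy' : G.Adj y y') : G.Adj q y' := by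
  by_contra hqy'
  have hy'Z : y' ∉ (Z : Set V) := fun h ↦
    Finset.disjoint_left.mp hZT h (Finset.mem_union_right _ hy')
  have hZsub : (Z : Set V) ⊆ {v | v ∉ closedNbhd G T} := fun v hv ↦ Finset.disjoint_left.mp hZT hv
  obtain ⟨p, hpl, hpZ, hp⟩ :=
    exists_isInducedPath_succ hly.2 hly'.2 hl hlq hqZ hy'Z hqy hyy' hqy'
  obtain ⟨p', hpl', hpZ', hp'⟩ := exists_isInducedPath_of_isLeast hly'
  have heven := hG.even_length_add_length hT hx hy' hp hp' (by lia) (by lia)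
    (hpZ.mono (Set.insert_subset hy hZsub)) (hpZ'.mono hZsub)
  rw [Nat.even_iff] at heven
  lia

end Neighbourhoods

lemma exists_seq_of_step {α : Type*} {P : ℕ → α → Prop} {r : α → α → Prop} {a : α} (ha : P 0 a)
    (hstep : ∀ i a, P i a → ∃ b, P (i + 1) b ∧ r a b) :
    ∃ f : ℕ → α, ∀ i, P i (f i) ∧ r (f i) (f (i + 1)) := by
  have : Nonempty α := ⟨a⟩
  choose! g hg using hstep
  let f : ℕ → α := Nat.rec a g
  have hf (i : ℕ) : P i (f i) := by
    induction i with
    | zero => exact ha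
    | succ i ih => exact (hg i _ ih).1
  exact ⟨f, fun i ↦ ⟨hf i, (hg i _ (hf i)).2⟩⟩

/-- Pigeonhole: among the `D` pieces of size at most `a` into which `S` splits, one has an image
of at least the average size. -/
lemma exists_subset_card_le_of_card_union_le {α β : Type*} [DecidableEq α] {f : Finset α → Finset β}
    (hf : ∀ S T, (f (S ∪ T)).card ≤ (f S).card + (f T).card) {a m D : ℕ} (hD : 1 ≤ D)
    {S : Finset α} (hS : S.card ≤ D * a) (hfS : D * m ≤ (f S).card) :
    ∃ S' ⊆ S, S'.card ≤ a ∧ m ≤ (f S').card := by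
  induction D, hD using Nat.le_induction generalizing S with
  | base => exact ⟨S, subset_rfl, by rwa [one_mul] at hS, by rwa [one_mul] at hfS⟩
  | succ D _ ih =>
    obtain ⟨S₁, hS₁, hcard⟩ := Finset.exists_subset_card_eq (min_le_right a S.card)
    by_cases hm : m ≤ (f S₁).card
    · exact ⟨S₁, hS₁, hcard ▸ min_le_left _ _, hm⟩
    have hsplit := hf S₁ (S \ S₁)
    rw [Finset.union_sdiff_of_subset hS₁] at hsplit
    rw [Nat.succ_mul] at hS hfS
    obtain ⟨S', hS', hcard', hm'⟩ := ih (S := S \ S₁)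
      (by rw [Finset.card_sdiff_of_subset hS₁]; lia) (by lia)
    exact ⟨S', hS'.trans Finset.sdiff_subset, hcard', hm'⟩

/-- Any two disjoint sets of at least `m` vertices are joined by an edge. -/
def IsJoined {V : Type*} (G : SimpleGraph V) (m : ℕ) : Prop :=
  ∀ A B : Finset V, Disjoint A B → m ≤ A.card → m ≤ B.card → ¬ G.AnticompleteTo A B

section Expansion

variable {V : Type*} [Fintype V] [DecidableEq V] {G : SimpleGraph V} [DecidableRel G.Adj]
  {S T Z : Finset V} {B : ℕ → Finset V} {v x : V} {i m D K Δ : ℕ}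

lemma IsJoined.card_sdiff_nbhd_lt (hG : IsJoined G m) (hS : m ≤ S.card) (hST : Disjoint S T) :
    (T \ nbhd G S).card < m := by
  by_contra! hcard
  refine hG S (T \ nbhd G S) (hST.mono_right Finset.sdiff_subset) hS hcard fun a ha b hb hab ↦ ?_
  exact (Finset.mem_sdiff.mp hb).2 (mem_nbhd.mpr ⟨a, ha, hab⟩)

lemma IsJoined.card_lt_card_nbhd_inter (hG : IsJoined G m) (hS : m ≤ S.card) (T : Finset V) :
    T.card < (nbhd G S ∩ T).card + 2 * m := by
  obtain ⟨S', hS', hcard⟩ := Finset.exists_subset_card_eq hS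
  have hmissed : ((T \ S') \ nbhd G S').card < m :=
    hG.card_sdiff_nbhd_lt hcard.ge Finset.disjoint_sdiff
  have hcover : T ⊆ (nbhd G S ∩ T) ∪ (S' ∪ ((T \ S') \ nbhd G S')) := by
    intro v hv
    have hmono := @nbhd_mono V _ _ G _ _ _ hS' v
    simp only [Finset.mem_union, Finset.mem_inter, Finset.mem_sdiff]
    tauto
  have := Finset.card_le_card hcover
  have := Finset.card_union_le (nbhd G S ∩ T) (S' ∪ ((T \ S') \ nbhd G S'))
  have := Finset.card_union_le S' ((T \ S') \ nbhd G S')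
  lia

/-- The ends of the walks `v₀ v₁ … vᵢ` with `v₀ ∈ S` and `vⱼ₊₁ ∈ B j` for all `j < i`. -/
def reach (G : SimpleGraph V) [DecidableRel G.Adj] (B : ℕ → Finset V) :
    ℕ → Finset V → Finset V
  | 0, S => S
  | i + 1, S => nbhd G (reach G B i S) ∩ B i

lemma mem_reach_succ : v ∈ reach G B (i + 1) S ↔ (∃ u ∈ reach G B i S, G.Adj u v) ∧ v ∈ B i := by
  rw [reach, Finset.mem_inter, mem_nbhd]

lemma reach_union (S T : Finset V) : reach G B i (S ∪ T) = reach G B i S ∪ reach G B i T := by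
  induction i with
  | zero => rfl
  | succ i ih => simp only [reach, ih, nbhd_union, Finset.union_inter_distrib_right]

lemma reach_empty : reach G B i ∅ = ∅ := by
  induction i with
  | zero => rfl
  | succ i ih => simp [reach, ih, nbhd]

lemma reach_subset_of_nbhd_subset (hT : nbhd G T ⊆ T) (hS : S ⊆ T) : reach G B i S ⊆ T := by
  induction i with
  | zero => exact hS
  | succ i ih => exact Finset.inter_subset_left.trans ((nbhd_mono ih).trans hT)

lemma mem_lengthsThrough_of_mem_reach (hv : v ∈ reach G (fun _ ↦ Z) i {x}) :
    i ∈ lengthsThrough G Z x v := by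
  induction i generalizing v with
  | zero =>
    obtain rfl := Finset.mem_singleton.mp hv
    exact ⟨Walk.nil, rfl, fun i _ hi ↦ absurd hi (Nat.not_lt_zero i)⟩
  | succ i ih =>
    obtain ⟨⟨u, hu, huv⟩, -⟩ := mem_reach_succ.mp hv
    refine succ_mem_lengthsThrough (ih hu) (fun hi ↦ ?_) huv
    obtain ⟨j, rfl⟩ := Nat.exists_eq_succ_of_ne_zero hi
    exact (mem_reach_succ.mp hu).2

/-- Start from `m ≤ D ^ K` vertices of `A`. Each step multiplies the size of the reached set by at
least `D`, so that a `D`-th part of the starting vertices still reaches `m` vertices. -/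
lemma IsJoined.exists_card_le_reach (hG : IsJoined G m) (hm : 1 ≤ m) (hD : 1 ≤ D)
    (hmD : m ≤ D ^ K) {A : Finset V} (hA : m ≤ A.card)
    (hB : ∀ i < K, D * m + 2 * m ≤ (B i).card) : ∃ v ∈ A, m ≤ (reach G B K {v}).card := by
  have hreach (i : ℕ) (hi : i ≤ K) :
      ∃ S ⊆ A, S.card ≤ D ^ (K - i) ∧ m ≤ (reach G B i S).card := by
    induction i with
    | zero =>
      obtain ⟨S, hS, hcard⟩ := Finset.exists_subset_card_eq hA
      exact ⟨S, hS, hcard.trans_le hmD, hcard.ge⟩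
    | succ i ih =>
      obtain ⟨S, hSA, hcard, hS⟩ := ih (by lia)
      have hgrow : D * m ≤ (reach G B (i + 1) S).card := by
        have := hG.card_lt_card_nbhd_inter hS (B i)
        have := hB i (by lia)
        rw [reach]
        lia
      obtain ⟨S', hS', hcard', hm'⟩ := exists_subset_card_le_of_card_union_le
        (fun S T ↦ reach_union (G := G) (B := B) S T ▸ Finset.card_union_le _ _) hD
        (a := D ^ (K - (i + 1)))
        (by rwa [← pow_succ', show K - (i + 1) + 1 = K - i by lia]) hgrow
      exact ⟨S', hS'.trans hSA, hcard', hm'⟩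
  obtain ⟨S, hSA, hcard, hS⟩ := hreach K le_rfl
  rw [Nat.sub_self, pow_zero] at hcard
  rcases S.eq_empty_or_nonempty with rfl | ⟨v, hv⟩
  · rw [reach_empty, Finset.card_empty] at hS
    lia
  · obtain rfl : {v} = S :=
      Finset.eq_of_subset_of_card_le (Finset.singleton_subset_iff.mpr hv) hcard
    exact ⟨v, hSA hv, hS⟩

lemma preconnected_induce_insert (hT : (G.induce (T : Set V)).Preconnected) {w : V}
    (hw : w ∈ nbhd G T) : (G.induce ((insert w T : Finset V) : Set V)).Preconnected := by
  obtain ⟨t, ht, htw⟩ := mem_nbhd.mp hw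
  have hpair : (G.induce {w, t}).Connected := induce_pair_connected_of_adj htw.symm
  have hunion : ((insert w T : Finset V) : Set V) = ({w, t} : Set V) ∪ T := by
    rw [Finset.coe_insert, Set.insert_union, Set.singleton_union,
      Set.insert_eq_of_mem (Finset.mem_coe.mpr ht)]
  rw [hunion]
  exact (induce_union_connected hpair.preconnected hT ⟨t, by simp, ht⟩).preconnected

lemma card_closedNbhd_singleton_le (hΔ : ∀ v, G.degree v ≤ Δ) (v : V) :
    (closedNbhd G {v}).card ≤ 1 + Δ := by
  rw [closedNbhd, nbhd, Finset.singleton_biUnion]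
  refine (Finset.card_union_le _ _).trans ?_
  rw [Finset.card_singleton, G.card_neighborFinset_eq_degree]
  exact Nat.add_le_add_left (hΔ v) 1

lemma card_closedNbhd_insert_le (hΔ : ∀ v, G.degree v ≤ Δ) {w : V} (hw : w ∈ nbhd G T) :
    (closedNbhd G (insert w T)).card ≤ (closedNbhd G T).card + Δ := by
  have hsub : closedNbhd G (insert w T) ⊆ closedNbhd G T ∪ G.neighborFinset w := by
    intro v
    simp only [closedNbhd, nbhd, Finset.biUnion_insert, Finset.mem_union, Finset.mem_insert] at hw ⊢
    rintro ((rfl | hv) | hv | hv) <;> tauto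
  calc (closedNbhd G (insert w T)).card
      ≤ (closedNbhd G T).card + (G.neighborFinset w).card :=
        (Finset.card_le_card hsub).trans (Finset.card_union_le _ _)
    _ ≤ (closedNbhd G T).card + Δ := by
        rw [G.card_neighborFinset_eq_degree]
        exact Nat.add_le_add_left (hΔ w) _

/-- Add vertices to `T` one at a time; the closed neighbourhood grows by at most `Δ` each time. -/
lemma IsJoined.exists_preconnected_superset {θ : ℕ} (hG : IsJoined G m)
    (hΔ : ∀ v, G.degree v ≤ Δ) (hlarge : ∀ S, T ⊆ S → nbhd G S ⊆ S → m ≤ S.card)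
    (hT : (G.induce (T : Set V)).Preconnected) (hTθ : (closedNbhd G T).card ≤ θ + Δ)
    (hθ : θ + m ≤ Fintype.card V) :
    ∃ T', T ⊆ T' ∧ (G.induce (T' : Set V)).Preconnected ∧ θ ≤ (closedNbhd G T').card ∧
      (closedNbhd G T').card ≤ θ + Δ := by
  let F : Finset (Finset V) := Finset.univ.filter fun S ↦
    T ⊆ S ∧ (G.induce (S : Set V)).Preconnected ∧ (closedNbhd G S).card ≤ θ + Δ
  obtain ⟨S, hSF, hmax⟩ := F.exists_max_image Finset.card
    ⟨T, Finset.mem_filter.mpr ⟨Finset.mem_univ _, subset_rfl, hT, hTθ⟩⟩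
  obtain ⟨-, hTS, hS, hSθ⟩ := Finset.mem_filter.mp hSF
  refine ⟨S, hTS, hS, ?_, hSθ⟩
  by_contra! hlt
  have hnot : ¬ nbhd G S ⊆ S := by
    intro hsub
    have hrest := hG.card_sdiff_nbhd_lt (hlarge S hTS hsub) (disjoint_compl_right (a := S))
    rw [Finset.sdiff_eq_self_of_disjoint (disjoint_compl_left.mono_right hsub),
      Finset.card_compl] at hrest
    have : S.card ≤ (closedNbhd G S).card := Finset.card_le_card Finset.subset_union_left
    lia
  obtain ⟨w, hw, hwS⟩ := Finset.not_subset.mp hnot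
  have hcard := hmax (insert w S) (Finset.mem_filter.mpr ⟨Finset.mem_univ _,
    hTS.trans (Finset.subset_insert w S), preconnected_induce_insert hS hw,
    (card_closedNbhd_insert_le hΔ hw).trans (by lia)⟩)
  rw [Finset.card_insert_of_notMem hwS] at hcard
  lia

lemma IsJoined.exists_preconnected_chain (hG : IsJoined G m) (hm : 1 ≤ m) (hD : 1 ≤ D)
    (hmD : m ≤ D ^ K) (hcard : D * m + 2 * m ≤ Fintype.card V) (hΔ : ∀ v, G.degree v ≤ Δ)
    {θ : ℕ → ℕ} (hθ : Monotone θ) (hθ0 : 1 ≤ θ 0) :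
    ∃ T : ℕ → Finset V, Monotone T ∧ ∀ i, (G.induce (T i : Set V)).Preconnected ∧
      (closedNbhd G (T i)).card ≤ θ i + Δ ∧
      (θ i + m ≤ Fintype.card V → θ i ≤ (closedNbhd G (T i)).card) := by
  obtain ⟨v, -, hv⟩ := hG.exists_card_le_reach (B := fun _ ↦ Finset.univ) (A := Finset.univ) hm hD
    hmD (by rw [Finset.card_univ]; lia) (fun i _ ↦ by rwa [Finset.card_univ])
  have hlarge (S : Finset V) (hvS : v ∈ S) (hS : nbhd G S ⊆ S) : m ≤ S.card :=
    hv.trans (Finset.card_le_card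
      (reach_subset_of_nbhd_subset hS (Finset.singleton_subset_iff.mpr hvS)))
  have hv' : (G.induce (({v} : Finset V) : Set V)).Preconnected := by
    rw [Finset.coe_singleton]
    exact .of_subsingleton
  let P (i : ℕ) (T : Finset V) : Prop := v ∈ T ∧ (G.induce (T : Set V)).Preconnected ∧
    (closedNbhd G T).card ≤ θ i + Δ ∧ (θ i + m ≤ Fintype.card V → θ i ≤ (closedNbhd G T).card)
  have hP (i : ℕ) {T : Finset V} (hvT : v ∈ T) (hT : (G.induce (T : Set V)).Preconnected)
      (hle : (closedNbhd G T).card ≤ θ i + Δ) : ∃ T', T ⊆ T' ∧ P i T' := by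
    by_cases hn : θ i + m ≤ Fintype.card V
    · obtain ⟨T', hTT', hT', hge, hle⟩ := hG.exists_preconnected_superset hΔ
        (fun S hTS ↦ hlarge S (hTS hvT)) hT hle hn
      exact ⟨T', hTT', hTT' hvT, hT', hle, fun _ ↦ hge⟩
    · exact ⟨T, subset_rfl, hvT, hT, hle, fun h ↦ absurd h hn⟩
  obtain ⟨T₀, -, hT₀⟩ := hP 0 (Finset.mem_singleton_self v) hv'
    ((card_closedNbhd_singleton_le hΔ v).trans (Nat.add_le_add_right hθ0 Δ))
  obtain ⟨T, hT⟩ := exists_seq_of_step (r := fun S T : Finset V ↦ S ⊆ T) hT₀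
    fun i T ⟨hvT, hT, hle, _⟩ ↦ (hP (i + 1) hvT hT
      (hle.trans (Nat.add_le_add_right (hθ i.le_succ) Δ))).imp fun _ h ↦ h.symm
  exact ⟨T, monotone_nat_of_le_succ fun i ↦ (hT i).2, fun i ↦ (hT i).1.2⟩

end Expansion

lemma exists_descending_of_mul_lt {α : Type*} {P : ℕ → α → Prop} {s : Finset α} {k r : ℕ}
    (hP : ∀ j < k, ∃ l ∈ s, P j l) (hk : s.card * r < k) :
    ∃ l ∈ s, ∃ idx : ℕ → ℕ, (∀ i, idx i < k ∧ P (idx i) l) ∧ ∀ i < r, idx (i + 1) < idx i := by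
  obtain ⟨l₀, -⟩ := hP 0 (by lia)
  have : Nonempty α := ⟨l₀⟩
  classical
  choose! L hLs hLP using hP
  obtain ⟨l, hl, hfib⟩ := Finset.exists_lt_card_fiber_of_mul_lt_card_of_maps_to
    (s := Finset.range k) (t := s) (f := L) (n := r)
    (fun j hj ↦ hLs j (Finset.mem_range.mp hj)) (by rwa [Finset.card_range])
  obtain ⟨J, hJ, hJcard⟩ := Finset.exists_subset_card_eq (Nat.succ_le_of_lt hfib)
  let e := J.orderEmbOfFin hJcard
  refine ⟨l, hl, fun i ↦ e ⟨r - i, by lia⟩, fun i ↦ ?_, fun i hi ↦ ?_⟩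
  · obtain ⟨hrange, hLl⟩ := Finset.mem_filter.mp (hJ (J.orderEmbOfFin_mem hJcard ⟨r - i, by lia⟩))
    exact ⟨Finset.mem_range.mp hrange, hLl ▸ hLP _ (Finset.mem_range.mp hrange)⟩
  · exact e.lt_iff_lt.mpr (Fin.mk_lt_mk.mpr (by lia))

section Comb

variable {V : Type*} {G : SimpleGraph V} {Z S : Finset V} {x y : V} {T Y : ℕ → Finset V}
  {j l m D K Δ : ℕ}

open Classical in
/-- The vertices of `S` for which the shortest walks from `x` with interior in `Z` have length
`l + 1`. -/
noncomputable def level (G : SimpleGraph V) (Z : Finset V) (x : V) (S : Finset V) (l : ℕ) :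
    Finset V :=
  {y ∈ S | IsLeast (lengthsThrough G Z x y) (l + 1)}

lemma mem_level : y ∈ level G Z x S l ↔ y ∈ S ∧ IsLeast (lengthsThrough G Z x y) (l + 1) := by
  simp only [level, Finset.mem_filter]

variable [Fintype V] [DecidableEq V] [DecidableRel G.Adj]

/-- A root `x` together with nested connected sets `T j` attached to it, blocks `Y j` of vertices
attached to `T (j + 1)` but not to `T j`, and a set `Z` away from all the `T j`. The root and the
blocks are joined by walks through `Z`, and by walks through the sets `T j`. -/
structure IsComb (G : SimpleGraph V) [DecidableRel G.Adj] (Z : Finset V) (x : V)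
    (T Y : ℕ → Finset V) : Prop where
  monotone : Monotone T
  preconnected (j : ℕ) : (G.induce (T j : Set V)).Preconnected
  root_mem : x ∈ nbhd G (T 0)
  disjoint_closedNbhd (j : ℕ) : Disjoint Z (closedNbhd G (T j))
  block_subset (j : ℕ) : Y j ⊆ nbhd G (T (j + 1))
  block_disjoint (j : ℕ) : Disjoint (Y j) (closedNbhd G (T j))
  block_disjoint_root (j : ℕ) : Disjoint (Y j) (closedNbhd G {x})

lemma IsJoined.card_lt_of_card_closedNbhd_add_le (hG : IsJoined G m)
    (hT : (closedNbhd G S).card + 2 * m ≤ Fintype.card V) : S.card < m := by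
  by_contra! hcard
  have hexp := hG.card_lt_card_nbhd_inter hcard Finset.univ
  rw [Finset.inter_univ, Finset.card_univ] at hexp
  have : (nbhd G S).card ≤ (closedNbhd G S).card := Finset.card_le_card Finset.subset_union_right
  lia

lemma IsJoined.exists_isComb {β k : ℕ} (hG : IsJoined G m) (hm : 1 ≤ m) (hD : 1 ≤ D)
    (hmD : m ≤ D ^ K) (hΔ : ∀ v, G.degree v ≤ Δ) (hβ : D * m + 3 * m + 2 * Δ ≤ β)
    (hn : (2 * k + 3) * β ≤ Fintype.card V) :
    ∃ Z x T Y, IsComb G Z x T Y ∧ m ≤ (reach G (fun _ ↦ Z) K {x}).card ∧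
      ∀ j < k, β ≤ (Y j).card := by
  have hθ {i j : ℕ} (hij : i ≤ j) : (2 * i + 1) * β ≤ (2 * j + 1) * β :=
    Nat.mul_le_mul_right β (by lia)
  have : (2 * k + 3) * β = (2 * k + 1) * β + 2 * β := by ring
  have hβn : 3 * β ≤ Fintype.card V := (Nat.mul_le_mul_right β (by lia)).trans hn
  obtain ⟨T, hmono, hT⟩ := hG.exists_preconnected_chain hm hD hmD (by lia) hΔ
    (θ := fun i ↦ (2 * i + 1) * β) (fun i j ↦ hθ) (by lia)
  have hTk : (T k).card < m :=
    hG.card_lt_of_card_closedNbhd_add_le (by have := (hT k).2.1; lia)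
  have hnbhd (j : ℕ) (hj : j ≤ k) : (2 * j + 1) * β < (nbhd G (T j)).card + m := by
    have := (hT j).2.2 (by have := hθ hj; lia)
    have := Finset.card_union_le (T j) (nbhd G (T j))
    have := Finset.card_le_card (hmono hj)
    rw [closedNbhd] at *
    lia
  obtain ⟨x, hx, hreach⟩ := hG.exists_card_le_reach (A := nbhd G (T 0))
    (B := fun _ ↦ (closedNbhd G (T k))ᶜ) hm hD hmD (by have := hnbhd 0 k.zero_le; lia)
    (fun _ _ ↦ by rw [Finset.card_compl]; have := (hT k).2.1; lia)
  refine ⟨(closedNbhd G (T k))ᶜ, x, fun j ↦ T (min j k),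
    fun j ↦ (nbhd G (T (min (j + 1) k)) \ closedNbhd G (T (min j k))) \ closedNbhd G {x},
    ⟨fun i j hij ↦ hmono (min_le_min_right k hij), fun j ↦ (hT _).1, ?_, fun j ↦ ?_,
      fun j ↦ Finset.sdiff_subset.trans Finset.sdiff_subset,
      fun j ↦ Finset.sdiff_disjoint.mono_left Finset.sdiff_subset,
      fun j ↦ Finset.sdiff_disjoint⟩, hreach, fun j hj ↦ ?_⟩
  · rwa [Nat.zero_min]
  · exact disjoint_compl_left.mono_right (closedNbhd_mono (hmono (min_le_right j k)))
  · simp only [min_eq_left hj.le, min_eq_left (Nat.succ_le_of_lt hj)]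
    have := hnbhd (j + 1) hj
    have := (hT j).2.1
    have := card_closedNbhd_singleton_le hΔ x
    have := Finset.le_card_sdiff (closedNbhd G (T j)) (nbhd G (T (j + 1)))
    have := Finset.le_card_sdiff (closedNbhd G {x}) (nbhd G (T (j + 1)) \ closedNbhd G (T j))
    have : (2 * (j + 1) + 1) * β = (2 * j + 1) * β + 2 * β := by ring
    lia

lemma IsComb.two_le_of_mem_lengthsThrough (h : IsComb G Z x T Y) (hy : y ∈ Y j)
    (hl : l ∈ lengthsThrough G Z x y) : 2 ≤ l := by
  have hxy : y ∉ closedNbhd G {x} := Finset.disjoint_left.mp (h.block_disjoint_root j) hy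
  simp only [mem_closedNbhd, Finset.mem_singleton, exists_eq_left, not_or] at hxy
  obtain ⟨p, rfl, -⟩ := hl
  exact two_le_length (fun e ↦ hxy.1 e.symm) hxy.2

lemma IsComb.exists_card_le_level {μ : ℕ} (h : IsComb G Z x T Y) (hG : IsJoined G m)
    (hreach : m ≤ (reach G (fun _ ↦ Z) K {x}).card) (hY : K * μ + 2 * m ≤ (Y j).card) :
    ∃ l ∈ Finset.Icc 1 K, μ ≤ (level G Z x (Y j) l).card := by
  by_contra! hsmall
  have hexp := hG.card_lt_card_nbhd_inter hreach (Y j)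
  have hcover : nbhd G (reach G (fun _ ↦ Z) K {x}) ∩ Y j ⊆
      (Finset.Icc 1 K).biUnion (level G Z x (Y j)) := by
    intro y hy
    obtain ⟨hyR, hyY⟩ := Finset.mem_inter.mp hy
    obtain ⟨r, hr, hry⟩ := mem_nbhd.mp hyR
    have hK : K + 1 ∈ lengthsThrough G Z x y := by
      refine succ_mem_lengthsThrough (mem_lengthsThrough_of_mem_reach hr) (fun hK ↦ ?_) hry
      obtain ⟨i, rfl⟩ := Nat.exists_eq_succ_of_ne_zero hK
      exact (mem_reach_succ.mp hr).2
    have hleast : IsLeast (lengthsThrough G Z x y) (sInf (lengthsThrough G Z x y)) :=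
      ⟨Nat.sInf_mem ⟨_, hK⟩, fun _ ↦ Nat.sInf_le⟩
    obtain ⟨l, hl⟩ := Nat.exists_eq_add_of_le' (h.two_le_of_mem_lengthsThrough hyY hleast.1)
    rw [hl] at hleast
    exact Finset.mem_biUnion.mpr ⟨l + 1, Finset.mem_Icc.mpr ⟨by lia, by have := hleast.2 hK; lia⟩,
      mem_level.mpr ⟨hyY, hleast⟩⟩
  have hcard := (Finset.card_le_card hcover).trans
    (Finset.card_biUnion_le_card_mul _ _ _ fun l hl ↦ (hsmall l hl).le)
  rw [Nat.card_Icc, Nat.add_sub_cancel] at hcard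
  lia

/-- The common neighbour is the last interior vertex `q` of a shortest walk from `x` to `y₀`. Since
the blocks are visited in descending order, `OddHoleFree.adj_of_isLeast` applies at each step. -/
lemma IsComb.exists_forall_mem_reach_adj {idx : ℕ → ℕ} {r : ℕ} (h : IsComb G Z x T Y)
    (hG : OddHoleFree G) (hl : l ≠ 0) (hidx : ∀ i < r, idx (i + 1) < idx i)
    (hy : y ∈ level G Z x (Y (idx 0)) l) :
    ∃ q, ∀ i ≤ r, ∀ z ∈ reach G (fun i ↦ level G Z x (Y (idx (i + 1))) l) i {y}, G.Adj q z := by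
  obtain ⟨p, hpl, hpZ⟩ := (mem_level.mp hy).2.1
  have hlq : l ∈ lengthsThrough G Z x (p.getVert l) := hpZ.mem_lengthsThrough_getVert (by lia)
  have hqZ : p.getVert l ∈ Z := hpZ l (by lia) (by lia)
  have hqy : G.Adj (p.getVert l) y := by
    have := p.adj_getVert_succ (i := l) (by lia)
    rwa [← hpl, p.getVert_length] at this
  refine ⟨p.getVert l, fun i hi ↦ ?_⟩
  suffices hstep : ∀ z ∈ reach G (fun i ↦ level G Z x (Y (idx (i + 1))) l) i {y},
      z ∈ level G Z x (Y (idx i)) l ∧ G.Adj (p.getVert l) z from fun z hz ↦ (hstep z hz).2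
  induction i with
  | zero =>
    intro z hz
    obtain rfl := Finset.mem_singleton.mp hz
    exact ⟨hy, hqy⟩
  | succ i ih =>
    intro z' hz'
    obtain ⟨⟨z, hz, hzz'⟩, hz'level⟩ := mem_reach_succ.mp hz'
    obtain ⟨hzlevel, hqz⟩ := ih (by lia) z hz
    obtain ⟨hzY, hzl⟩ := mem_level.mp hzlevel
    obtain ⟨hz'Y, hz'l⟩ := mem_level.mp hz'level
    refine ⟨hz'level, hG.adj_of_isLeast (h.preconnected (idx (i + 1) + 1))
      (h.disjoint_closedNbhd _) (nbhd_mono (h.monotone (Nat.zero_le _)) h.root_mem) ?_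
      (h.block_subset _ hz'Y) hl hzl hz'l hlq hqZ hqz hzz'⟩
    exact fun hzT ↦ Finset.disjoint_left.mp (h.block_disjoint _) hzY
      (closedNbhd_mono (h.monotone (hidx i (by lia))) hzT)

end Comb

theorem OddHoleFree.not_isJoined {V : Type*} [Fintype V] {G : SimpleGraph V} [DecidableRel G.Adj]
    {m D K Δ : ℕ} (hG : OddHoleFree G) (hm : 1 ≤ m) (hD : 1 ≤ D) (hK : 1 ≤ K) (hmD : m ≤ D ^ K)
    (hΔ : ∀ v, G.degree v ≤ Δ)
    (hn : (2 * (K * (K + 1) + 1) + 3) * (K * (D * m + 2 * m + Δ) + 3 * m + Δ) ≤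
      Fintype.card V) : ¬ IsJoined G m := by
  classical
  intro hjoined
  have hKμ : D * m + 2 * m + Δ ≤ K * (D * m + 2 * m + Δ) := Nat.le_mul_of_pos_left _ hK
  obtain ⟨Z, x, T, Y, hcomb, hreach, hY⟩ :=
    hjoined.exists_isComb hm hD hmD hΔ (by lia) hn
  obtain ⟨l, hl, idx, hidx, hdesc⟩ := exists_descending_of_mul_lt (r := K + 1)
    (P := fun j l ↦ D * m + 2 * m + Δ ≤ (level G Z x (Y j) l).card)
    (fun j hj ↦ hcomb.exists_card_le_level hjoined hreach (by have := hY j hj; lia))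
    (by rw [Nat.card_Icc, Nat.add_sub_cancel]; lia)
  obtain ⟨y, hy, hyreach⟩ := hjoined.exists_card_le_reach
    (A := level G Z x (Y (idx 0)) l) (B := fun i ↦ level G Z x (Y (idx (i + 1))) l) hm hD hmD
    (by have := (hidx 0).2; lia) (fun i _ ↦ by have := (hidx (i + 1)).2; lia)
  obtain ⟨q, hq⟩ := hcomb.exists_forall_mem_reach_adj hG
    (Nat.one_le_iff_ne_zero.mp (Finset.mem_Icc.mp hl).1) hdesc hy
  have hsub := Finset.card_le_card fun z hz ↦
    (G.mem_neighborFinset q z).mpr (hq (K + 1) le_rfl z hz)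
  rw [reach, G.card_neighborFinset_eq_degree] at hsub
  have hexp := hjoined.card_lt_card_nbhd_inter hyreach (level G Z x (Y (idx (K + 1))) l)
  have := (hidx (K + 1)).2
  have := hΔ q
  lia

section Sparse

variable {V : Type*} {G : SimpleGraph V} {A B S W : Finset V} {v : V} {ε : ℝ}

open Classical in
/-- The number of neighbours of `v` in `S`. -/
noncomputable def degIn (G : SimpleGraph V) (v : V) (S : Finset V) : ℕ :=
  (S.filter (G.Adj v)).card

/-- Each vertex of `A` is adjacent to at most a proportion `ε` of the vertices of `B`. -/
def SparseTo (G : SimpleGraph V) (ε : ℝ) (A B : Finset V) : Prop :=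
  ∀ v ∈ A, (degIn G v B : ℝ) ≤ ε * B.card

lemma SparseTo.mono_left (h : SparseTo G ε B W) (hAB : A ⊆ B) : SparseTo G ε A W :=
  fun v hv ↦ h v (hAB hv)

lemma degIn_mono (h : A ⊆ B) : degIn G v A ≤ degIn G v B := by
  classical
  exact Finset.card_le_card (Finset.filter_subset_filter _ h)

lemma degIn_le_card : degIn G v S ≤ S.card := by
  classical
  exact Finset.card_filter_le _ _

lemma degIn_singleton_self : degIn G v {v} = 0 := by
  simp [degIn, Finset.filter_singleton]

lemma degIn_union [DecidableEq V] (h : Disjoint A B) :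
    degIn G v (A ∪ B) = degIn G v A + degIn G v B := by
  classical
  rw [degIn, Finset.filter_union, Finset.card_union_of_disjoint (Finset.disjoint_filter_filter h)]
  rfl

lemma sum_degIn_comm (A B : Finset V) :
    ∑ v ∈ A, (degIn G v B : ℝ) = ∑ u ∈ B, (degIn G u A : ℝ) := by
  classical
  norm_cast
  simp only [degIn, Finset.card_filter]
  rw [Finset.sum_comm]
  simp only [G.adj_comm]

lemma exists_subset_sparseTo (hε : 0 ≤ ε)
    (hW : ∑ v ∈ W, (degIn G v W : ℝ) ≤ ε / 4 * (W.card : ℝ) ^ 2) :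
    ∃ W' ⊆ W, (W.card : ℝ) / 2 ≤ W'.card ∧ SparseTo G ε W' W' := by
  classical
  let high := W.filter fun v ↦ ε / 2 * W.card < degIn G v W
  let low := W.filter fun v ↦ ¬ ε / 2 * W.card < degIn G v W
  have hsplit : (high.card : ℝ) + low.card = W.card := by
    exact_mod_cast Finset.card_filter_add_card_filter_not _
  have hlow : (W.card : ℝ) / 2 ≤ low.card := by
    by_contra! hlt
    have hhigh : high.Nonempty := by
      rw [← Finset.card_pos, ← Nat.cast_pos (α := ℝ)]
      linarith
    have hmarkov : high.card * (ε / 2 * W.card) < ∑ v ∈ W, (degIn G v W : ℝ) := by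
      rw [← nsmul_eq_mul, ← Finset.sum_const]
      exact (Finset.sum_lt_sum_of_nonempty hhigh fun v hv ↦ (Finset.mem_filter.mp hv).2).trans_le
        (Finset.sum_le_sum_of_subset_of_nonneg (Finset.filter_subset _ _)
          fun _ _ _ ↦ Nat.cast_nonneg _)
    have : 0 ≤ (W.card : ℝ) * ε := by positivity
    nlinarith
  refine ⟨low, Finset.filter_subset _ _, hlow, fun v hv ↦ ?_⟩
  calc (degIn G v low : ℝ) ≤ degIn G v W := mod_cast degIn_mono (Finset.filter_subset _ _)
    _ ≤ ε / 2 * W.card := not_lt.mp (Finset.mem_filter.mp hv).2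
    _ ≤ ε * low.card := by nlinarith

end Sparse

section Rodl

variable {V : Type*} {G : SimpleGraph V} {A B X : Finset V} {v : V} {ε η : ℝ} {s p h : ℕ}

lemma exists_mem_forall_of_card_mul_lt {α ι : Type*} [Fintype ι] {Q : ι → α → Prop}
    {A : Finset α} {a : ℝ} (hQ : ∀ i, ∀ A' ⊆ A, a ≤ A'.card → ∃ v ∈ A', Q i v)
    (hA : Fintype.card ι * a < A.card) : ∃ v ∈ A, ∀ i, Q i v := by
  classical
  by_contra! hbad
  have hsmall (i : ι) : ((A.filter fun v ↦ ¬ Q i v).card : ℝ) ≤ a := by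
    by_contra! hlarge
    obtain ⟨v, hv, hQv⟩ := hQ i _ (Finset.filter_subset _ A) hlarge.le
    exact (Finset.mem_filter.mp hv).2 hQv
  have hcover : A ⊆ Finset.univ.biUnion fun i ↦ A.filter fun v ↦ ¬ Q i v := fun v hv ↦ by
    obtain ⟨i, hi⟩ := hbad v hv
    exact Finset.mem_biUnion.mpr ⟨i, Finset.mem_univ i, Finset.mem_filter.mpr ⟨hv, hi⟩⟩
  have hcard : (A.card : ℝ) ≤ ∑ i, ((A.filter fun v ↦ ¬ Q i v).card : ℝ) := by
    exact_mod_cast (Finset.card_le_card hcover).trans Finset.card_biUnion_le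
  have hsum := Finset.sum_le_card_nsmul Finset.univ _ a fun i _ ↦ hsmall i
  rw [nsmul_eq_mul, Finset.card_univ] at hsum
  linarith

open Classical in
lemma exists_mem_lt_card_filter_adj_iff (hG : ¬ SparseTo G ε A B)
    (hGc : ¬ SparseTo Gᶜ ε A B) (P : Prop) :
    ∃ v ∈ A, ε * B.card < (B.filter fun u ↦ G.Adj v u ↔ P).card := by
  simp only [SparseTo, degIn, not_forall, not_le, exists_prop] at hG hGc
  by_cases hP : P
  · simpa only [hP, iff_true] using hG
  · obtain ⟨v, hv, hlt⟩ := hGc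
    refine ⟨v, hv, hlt.trans_le (Nat.cast_le.mpr (Finset.card_le_card fun u hu ↦ ?_))⟩
    simp only [Finset.mem_filter] at hu ⊢
    exact ⟨hu.1, iff_of_false ((compl_adj G v u).mp hu.2).2 hP⟩

/-- Embed the vertices of `H` one at a time, each time shrinking the remaining candidate sets by a
factor of at most `ε`. -/
lemma exists_adj_iff_of_not_sparseTo {H : SimpleGraph (Fin h)} {a : ℝ} {U : Fin h → Finset V}
    (hε0 : 0 ≤ ε) (hε1 : ε ≤ 1) (ha : 0 < a) (hU : ∀ i, a * h ≤ ε ^ h * (U i).card)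
    (hpair : ∀ i j, i < j → ∀ A ⊆ U i, ∀ B ⊆ U j, a ≤ A.card → a ≤ B.card →
      ¬ SparseTo G ε A B ∧ ¬ SparseTo Gᶜ ε A B) :
    ∃ f : Fin h → V, (∀ i, f i ∈ U i) ∧ ∀ i j, i < j → (G.Adj (f i) (f j) ↔ H.Adj i j) := by
  classical
  induction h with
  | zero => exact ⟨finZeroElim, finZeroElim, finZeroElim⟩
  | succ n ih =>
    have hUn (i : Fin (n + 1)) : a * (n + 1) ≤ (U i).card := by
      have := (hU i).trans (mul_le_of_le_one_left (Nat.cast_nonneg _) (pow_le_one₀ hε0 hε1))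
      rwa [Nat.cast_succ] at this
    have hUa (i : Fin (n + 1)) : a ≤ (U i).card :=
      (le_mul_of_one_le_right ha.le (by simp)).trans (hUn i)
    obtain ⟨v, hv, hvU⟩ : ∃ v ∈ U 0, ∀ j : Fin n, ε * (U j.succ).card <
        ((U j.succ).filter fun u ↦ G.Adj v u ↔ H.Adj 0 j.succ).card := by
      refine exists_mem_forall_of_card_mul_lt (a := a) (fun j A hA hcard ↦ ?_) ?_
      · obtain ⟨hG, hGc⟩ := hpair 0 j.succ j.succ_pos A hA _ subset_rfl hcard (hUa _)
        exact exists_mem_lt_card_filter_adj_iff hG hGc _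
      · rw [Fintype.card_fin]
        linarith [hUn 0]
    let U' (j : Fin n) : Finset V := (U j.succ).filter fun u ↦ G.Adj v u ↔ H.Adj 0 j.succ
    have hU' (j : Fin n) : U' j ⊆ U j.succ := Finset.filter_subset _ _
    have hsize (j : Fin n) : a * n ≤ ε ^ n * (U' j).card := by
      have hle := mul_le_mul_of_nonneg_left (hvU j).le (pow_nonneg hε0 n)
      have hUj := hU j.succ
      rw [← mul_assoc, ← pow_succ] at hle
      push_cast at hUj
      linarith
    obtain ⟨f, hfU, hf⟩ := ih (H := H.comap Fin.succ) hsize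
      (fun i j hij A hA B hB ↦ hpair i.succ j.succ (Fin.succ_lt_succ_iff.mpr hij) A
        (hA.trans (hU' i)) B (hB.trans (hU' j)))
    refine ⟨Fin.cons v f, Fin.cases hv fun i ↦ hU' i (hfU i),
      Fin.cases (Fin.cases (fun h ↦ absurd h (lt_irrefl _)) fun j _ ↦ ?_) fun i ↦
        Fin.cases (fun h ↦ absurd h (Fin.not_lt_zero _)) fun j hij ↦ ?_⟩
    · exact (Finset.mem_filter.mp (hfU j)).2
    · exact hf i j (Fin.succ_lt_succ_iff.mp hij)

lemma isIndContained_of_forall_lt {H : SimpleGraph (Fin h)} {f : Fin h → V}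
    (hinj : Function.Injective f) (hf : ∀ i j, i < j → (G.Adj (f i) (f j) ↔ H.Adj i j)) :
    H ⊴ G := by
  refine ⟨⟨⟨f, hinj⟩, fun {i j} ↦ ?_⟩⟩
  rcases lt_trichotomy i j with hij | rfl | hij
  · exact hf i j hij
  · exact iff_of_false (G.irrefl) (H.irrefl)
  · rw [G.adj_comm, H.adj_comm]
    exact hf j i hij

lemma exists_disjoint_subsets (hh : h ≠ 0) (hX : h ≤ X.card) :
    ∃ U : Fin h → Finset V, (∀ i, U i ⊆ X ∧ X.card ≤ 2 * h * (U i).card) ∧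
      ∀ i j, i ≠ j → Disjoint (U i) (U j) := by
  classical
  obtain ⟨P, hP, hcard⟩ := Finpartition.exists_equipartition_card_eq X hh hX
  let e := (P.parts.equivFinOfCardEq hcard).symm
  refine ⟨fun i ↦ e i, fun i ↦ ⟨P.le (e i).2, ?_⟩, fun i j hij ↦ ?_⟩
  · have hpos := Nat.pos_of_ne_zero hh
    have hlt := Nat.lt_mul_div_succ X.card hpos
    have hone := Nat.mul_le_mul_left h (Nat.div_pos hX hpos)
    have haverage := Nat.mul_le_mul_left h (hcard ▸ hP.average_le_card_part (e i).2)
    lia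
  · exact P.disjoint (e i).2 (e j).2 fun h ↦ hij (e.injective (Subtype.ext h))

lemma exists_sparse_pair {H : SimpleGraph (Fin h)} (hH : ¬ H ⊴ G) (hε0 : 0 < ε) (hε1 : ε ≤ 1)
    (hX : h ≤ X.card) :
    ∃ A ⊆ X, ∃ B ⊆ X, Disjoint A B ∧ A.card ≤ B.card ∧
      ε ^ h / (2 * h ^ 2) * X.card ≤ A.card ∧ (SparseTo G ε A B ∨ SparseTo Gᶜ ε A B) := by
  rcases eq_or_ne h 0 with rfl | hh
  · exact absurd .of_isEmpty hH
  have hX' : (0 : ℝ) < X.card := mod_cast (Nat.pos_of_ne_zero hh).trans_le hX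
  by_contra! hnone
  obtain ⟨U, hU, hdisj⟩ := exists_disjoint_subsets hh hX
  have hsize (i : Fin h) : ε ^ h / (2 * h ^ 2) * X.card * h ≤ ε ^ h * (U i).card := by
    calc ε ^ h / (2 * h ^ 2) * X.card * h = ε ^ h * (X.card / (2 * h)) := by field_simp
      _ ≤ ε ^ h * (U i).card := by
        gcongr
        rw [div_le_iff₀' (by positivity)]
        exact_mod_cast (hU i).2
  have hpair (i j : Fin h) (hij : i < j) (A) (hA : A ⊆ U i) (B) (hB : B ⊆ U j)
      (hAcard : ε ^ h / (2 * h ^ 2) * X.card ≤ A.card)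
      (hBcard : ε ^ h / (2 * h ^ 2) * X.card ≤ B.card) :
      ¬ SparseTo G ε A B ∧ ¬ SparseTo Gᶜ ε A B := by
    obtain ⟨A', hA', hA'card⟩ := Finset.exists_subset_card_eq (min_le_left A.card B.card)
    obtain ⟨hG, hGc⟩ := hnone A' (hA'.trans (hA.trans (hU i).1)) B (hB.trans (hU j).1)
      ((hdisj i j hij.ne).mono (hA'.trans hA) hB) (hA'card ▸ min_le_right _ _)
      (by rw [hA'card, Nat.cast_min]; exact le_min hAcard hBcard)
    exact ⟨mt (·.mono_left hA') hG, mt (·.mono_left hA') hGc⟩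
  obtain ⟨f, hfU, hf⟩ := exists_adj_iff_of_not_sparseTo hε0.le hε1 (by positivity) hsize hpair
  refine hH (isIndContained_of_forall_lt (fun i j hij ↦ ?_) hf)
  by_contra hne
  exact Finset.disjoint_left.mp (hdisj i j hne) (hfU i) (hij ▸ hfU j)

lemma exists_subset_sum_le {α : Type*} {g : α → ℝ} {c : ℝ} {B : Finset α}
    (hB : ∑ b ∈ B, g b ≤ c * B.card) (hs : s ≤ B.card) :
    ∃ B' ⊆ B, B'.card = s ∧ ∑ b ∈ B', g b ≤ c * s := by
  classical
  induction B using Finset.strongInduction with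
  | H B ih =>
    rcases hs.eq_or_lt with rfl | hlt
    · exact ⟨B, subset_rfl, rfl, hB⟩
    by_cases hb : ∃ b ∈ B, c ≤ g b
    · obtain ⟨b, hb, hc⟩ := hb
      have hcard := Finset.card_erase_add_one hb
      obtain ⟨B', hB', hB's⟩ := ih (B.erase b) (Finset.erase_ssubset hb) (by
        rw [← Finset.add_sum_erase B g hb, ← hcard] at hB
        push_cast at hB
        linarith) (by lia)
      exact ⟨B', hB'.trans (Finset.erase_subset b B), hB's⟩
    · push Not at hb
      obtain ⟨B', hB', rfl⟩ := Finset.exists_subset_card_eq hs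
      refine ⟨B', hB', rfl, ?_⟩
      rw [mul_comm, ← nsmul_eq_mul]
      exact Finset.sum_le_card_nsmul _ _ _ fun b hb' ↦ (hb b (hB' hb')).le

/-- `X` contains `p * s` vertices spanning at most as many edges, counted twice, as there can be in
`p` disjoint sets of size `s` with densities at most `ε` between them. -/
def HasSparseBlocks (G : SimpleGraph V) (ε : ℝ) (X : Finset V) (s p : ℕ) : Prop :=
  ∃ W ⊆ X, W.card = p * s ∧ ∑ v ∈ W, (degIn G v W : ℝ) ≤ (p + ε * p ^ 2) * s ^ 2

lemma hasSparseBlocks_zero : HasSparseBlocks G ε X s 0 :=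
  ⟨∅, by simp⟩

lemma HasSparseBlocks.mono (hAX : A ⊆ X) (h : HasSparseBlocks G ε A s p) :
    HasSparseBlocks G ε X s p :=
  h.imp fun _ hW ↦ ⟨hW.1.trans hAX, hW.2⟩

lemma HasSparseBlocks.succ (hε : 0 ≤ ε) (h : HasSparseBlocks G ε A s p) (hAX : A ⊆ X)
    (hBX : B ⊆ X) (hAB : Disjoint A B) (hsparse : SparseTo G ε A B) (hs : s ≤ B.card) :
    HasSparseBlocks G ε X s (p + 1) := by
  classical
  obtain ⟨W, hWA, hWcard, hW⟩ := h
  have hBW : ∑ u ∈ B, (degIn G u W : ℝ) ≤ ε * W.card * B.card := by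
    rw [sum_degIn_comm]
    refine (Finset.sum_le_card_nsmul _ _ _ fun v hv ↦ hsparse v (hWA hv)).trans_eq ?_
    rw [nsmul_eq_mul]
    ring
  obtain ⟨B', hB', hB'card, hB'W⟩ := exists_subset_sum_le hBW hs
  have hB'B' : ∑ u ∈ B', (degIn G u B' : ℝ) ≤ s ^ 2 := by
    refine (Finset.sum_le_card_nsmul _ _ (s : ℝ) fun v _ ↦ ?_).trans_eq ?_
    · exact_mod_cast hB'card ▸ degIn_le_card
    · rw [nsmul_eq_mul, hB'card, sq]
  have hWB : Disjoint W B' := hAB.mono hWA hB'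
  refine ⟨W ∪ B', Finset.union_subset (hWA.trans hAX) (hB'.trans hBX), ?_, ?_⟩
  · rw [Finset.card_union_of_disjoint hWB, hWcard, hB'card, Nat.succ_mul]
  · rw [Finset.sum_union hWB]
    simp only [degIn_union hWB, Nat.cast_add, Finset.sum_add_distrib]
    rw [sum_degIn_comm W B']
    rw [hWcard] at hB'W
    push_cast at hB'W ⊢
    nlinarith [mul_nonneg hε (sq_nonneg (s : ℝ))]

lemma exists_hasSparseBlocks (hε : 0 ≤ ε) (hη0 : 0 ≤ η) (hη1 : η ≤ 1)
    (hpair : ∀ X : Finset V, h ≤ X.card → ∃ A ⊆ X, ∃ B ⊆ X, Disjoint A B ∧ A.card ≤ B.card ∧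
      η * X.card ≤ A.card ∧ (SparseTo G ε A B ∨ SparseTo Gᶜ ε A B))
    (p q : ℕ) (hX : h ≤ η ^ (p + q) * X.card) :
    ∃ s ≤ X.card, η ^ (p + q) * X.card ≤ s ∧
      (HasSparseBlocks G ε X s p ∨ HasSparseBlocks Gᶜ ε X s q) := by
  have hpow (n : ℕ) (X : Finset V) : η ^ n * X.card ≤ X.card :=
    mul_le_of_le_one_left (Nat.cast_nonneg _) (pow_le_one₀ hη0 hη1)
  induction p generalizing q X with
  | zero => exact ⟨X.card, le_rfl, hpow _ X, .inl hasSparseBlocks_zero⟩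
  | succ p ihp =>
    induction q generalizing X with
    | zero => exact ⟨X.card, le_rfl, hpow _ X, .inr hasSparseBlocks_zero⟩
    | succ q ihq =>
      obtain ⟨A, hA, B, hB, hAB, hcard, hηA, hsparse⟩ := hpair X (mod_cast hX.trans (hpow _ X))
      have hAX := Finset.card_le_card hA
      have hstep : η ^ (p + 1 + (q + 1)) * X.card ≤ η ^ (p + q + 1) * A.card := by
        rw [show p + 1 + (q + 1) = p + q + 1 + 1 by ring, pow_succ, mul_assoc]
        gcongr
      rcases hsparse with hsparse | hsparse
      · obtain ⟨s, hsA, hs, hblocks⟩ := ihp (q + 1) (hX.trans hstep)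
        exact ⟨s, hsA.trans hAX, hstep.trans hs, hblocks.imp
          (fun h ↦ h.succ hε hA hB hAB hsparse (hsA.trans hcard)) fun h ↦ h.mono hA⟩
      · rw [show p + q + 1 = p + 1 + q by ring] at hstep
        obtain ⟨s, hsA, hs, hblocks⟩ := ihq (hX.trans hstep)
        exact ⟨s, hsA.trans hAX, hstep.trans hs, hblocks.imp (fun h ↦ h.mono hA)
          fun h ↦ h.succ hε hA hB hAB hsparse (hsA.trans hcard)⟩

lemma HasSparseBlocks.exists_sparseTo (hε : 0 < ε) (hp : 8 / ε ≤ p)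
    (h : HasSparseBlocks G (ε / 8) X s p) :
    ∃ W ⊆ X, (s : ℝ) / 2 ≤ W.card ∧ SparseTo G ε W W := by
  obtain ⟨W, hWX, hWcard, hW⟩ := h
  have hp8 : 8 ≤ p * ε := (div_le_iff₀ hε).mp hp
  have hp1 : 1 ≤ p := Nat.one_le_iff_ne_zero.mpr fun h0 ↦ by
    rw [h0, Nat.cast_zero, zero_mul] at hp8
    linarith
  obtain ⟨W', hW'W, hW'card, hW'⟩ := exists_subset_sparseTo hε.le (hW.trans (by
    rw [hWcard, Nat.cast_mul, mul_pow, ← mul_assoc]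
    gcongr
    have : (p : ℝ) * 8 ≤ p * (p * ε) := by gcongr
    linarith))
  have hs : (s : ℝ) ≤ W.card := mod_cast hWcard ▸ Nat.le_mul_of_pos_left s hp1
  exact ⟨W', hW'W.trans hWX, by linarith, hW'⟩

lemma sparseTo_singleton_self (hε : 0 ≤ ε) : SparseTo G ε {v} {v} := fun u hu ↦ by
  rw [Finset.mem_singleton.mp hu, degIn_singleton_self, Nat.cast_zero]
  positivity

/-- **Rödl's theorem**. -/
theorem exists_sparseTo_or_sparseTo_compl (H : SimpleGraph (Fin h)) (hε0 : 0 < ε) (hε1 : ε ≤ 1) :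
    ∃ δ : ℝ, 0 < δ ∧ ∀ (V : Type u) (G : SimpleGraph V), ¬ H ⊴ G → ∀ X : Finset V, ∃ W ⊆ X,
      δ * X.card ≤ W.card ∧ (SparseTo G ε W W ∨ SparseTo Gᶜ ε W W) := by
  obtain ⟨p, hp⟩ := exists_nat_ge (8 / ε)
  let η : ℝ := (ε / 8) ^ h / (2 * h ^ 2)
  rcases eq_or_ne h 0 with rfl | hh
  · exact ⟨1, one_pos, fun V G hG ↦ absurd .of_isEmpty hG⟩
  have hh1 : (1 : ℝ) ≤ h := mod_cast Nat.one_le_iff_ne_zero.mpr hh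
  have hη0 : 0 < η := by positivity
  have hη1 : η ≤ 1 := div_le_one_of_le₀ ((pow_le_one₀ (by positivity) (by linarith)).trans
    (by nlinarith)) (by positivity)
  refine ⟨η ^ (p + p) / (2 * h), by positivity, fun V G hG X ↦ ?_⟩
  by_cases hX : h ≤ η ^ (p + p) * X.card
  · obtain ⟨s, -, hs, hblocks⟩ := exists_hasSparseBlocks (G := G) (ε := ε / 8) (by positivity)
      hη0.le hη1 (fun X hX ↦ exists_sparse_pair hG (by positivity) (by linarith) hX) p p hX
    have hδs : η ^ (p + p) / (2 * h) * X.card ≤ (s : ℝ) / 2 := by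
      calc η ^ (p + p) / (2 * h) * X.card = η ^ (p + p) * X.card / (2 * h) := by ring
        _ ≤ s / (2 * 1) := by gcongr
        _ = s / 2 := by ring
    rcases hblocks with hblocks | hblocks <;>
      obtain ⟨W, hWX, hW, hsparse⟩ := hblocks.exists_sparseTo hε0 hp
    · exact ⟨W, hWX, hδs.trans hW, .inl hsparse⟩
    · exact ⟨W, hWX, hδs.trans hW, .inr hsparse⟩
  · obtain rfl | ⟨v, hv⟩ := X.eq_empty_or_nonempty
    · exact ⟨∅, subset_rfl, by simp, .inl fun _ h ↦ absurd h (Finset.notMem_empty _)⟩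
    · refine ⟨{v}, Finset.singleton_subset_iff.mpr hv, ?_, .inl (sparseTo_singleton_self hε0.le)⟩
      rw [div_mul_eq_mul_div, Finset.card_singleton, div_le_iff₀ (by positivity)]
      push_cast
      linarith

end Rodl

section PurePairs

variable {V : Type*} {G : SimpleGraph V} {W : Finset V} {m D K Δ : ℕ} {c ε η : ℝ}

lemma degree_induce_eq_degIn (G : SimpleGraph V) (W : Finset V)
    [DecidableRel (G.induce (W : Set V)).Adj] (v : (W : Set V)) :
    (G.induce (W : Set V)).degree v = degIn G v W := by
  classical
  rw [← card_neighborFinset_eq_degree, ← Finset.card_map (.subtype _), degIn]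
  congr 1
  ext u
  simp [and_comm]

lemma OddHoleFree.exists_anticompleteTo (hG : OddHoleFree G) (hm : 1 ≤ m) (hD : 1 ≤ D)
    (hK : 1 ≤ K) (hmD : m ≤ D ^ K) (hΔ : ∀ v ∈ W, degIn G v W ≤ Δ)
    (hW : (2 * (K * (K + 1) + 1) + 3) * (K * (D * m + 2 * m + Δ) + 3 * m + Δ) ≤ W.card) :
    ∃ A B : Finset V, Disjoint A B ∧ m ≤ A.card ∧ m ≤ B.card ∧ G.AnticompleteTo A B := by
  classical
  have hG' : OddHoleFree (G.induce (W : Set V)) := hG.of_isIndContained ⟨.induce _⟩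
  have hnot := hG'.not_isJoined hm hD hK hmD
    (fun v ↦ (degree_induce_eq_degIn G W v).trans_le (hΔ v v.2))
    (by simpa only [Finset.coe_sort_coe, Fintype.card_coe] using hW)
  simp only [IsJoined, not_forall, not_not, exists_prop] at hnot
  obtain ⟨A, B, hAB, hA, hB, hanti⟩ := hnot
  refine ⟨A.map (.subtype _), B.map (.subtype _), (Finset.disjoint_map _).mpr hAB,
    by rwa [Finset.card_map], by rwa [Finset.card_map], fun a ha b hb ↦ ?_⟩
  obtain ⟨a', ha', rfl⟩ := Finset.mem_map.mp ha
  obtain ⟨b', hb', rfl⟩ := Finset.mem_map.mp hb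
  exact hanti a' ha' b' hb'

lemma OddHoleFree.exists_anticompleteTo_of_sparseTo (hG : OddHoleFree G)
    (hsparse : SparseTo G ε W W) (hm : 1 ≤ m) (hD : 1 ≤ D) (hK : 1 ≤ K) (hmD : m ≤ D ^ K)
    (hε : 5 * (2 * (K * (K + 1) + 1) + 3) * (K + 1) * ε ≤ 1) (hW : (D * m : ℝ) ≤ ε * W.card) :
    ∃ A B : Finset V, Disjoint A B ∧ m ≤ A.card ∧ m ≤ B.card ∧ G.AnticompleteTo A B := by
  have hεW : 0 ≤ ε * W.card := le_trans (by positivity) hW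
  refine hG.exists_anticompleteTo (Δ := ⌊ε * W.card⌋₊) hm hD hK hmD
    (fun v hv ↦ Nat.le_floor (hsparse v hv)) ?_
  have hmDm : m ≤ D * m := Nat.le_mul_of_pos_left m hD
  have hle : K * (D * m + 2 * m + ⌊ε * W.card⌋₊) + 3 * m + ⌊ε * W.card⌋₊ ≤
      (K + 1) * (4 * (D * m) + ⌊ε * W.card⌋₊) := by
    nlinarith
  have hreal : (4 * (D * m) + ⌊ε * W.card⌋₊ : ℝ) ≤ 5 * (ε * W.card) := by
    linarith [Nat.floor_le hεW]
  have hbound : ((2 * (K * (K + 1) + 1) + 3) * ((K + 1) * (4 * (D * m) + ⌊ε * W.card⌋₊)) : ℝ) ≤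
      W.card := by
    calc ((2 * (K * (K + 1) + 1) + 3) * ((K + 1) * (4 * (D * m) + ⌊ε * W.card⌋₊)) : ℝ)
        ≤ (2 * (K * (K + 1) + 1) + 3) * ((K + 1) * (5 * (ε * W.card))) := by gcongr
      _ = 5 * (2 * (K * (K + 1) + 1) + 3) * (K + 1) * ε * W.card := by ring
      _ ≤ W.card := mul_le_of_le_one_left (Nat.cast_nonneg _) hε
  exact (Nat.mul_le_mul_left _ hle).trans (mod_cast hbound)

lemma eventually_ceil_rpow_le_pow_and_mul_le (hc0 : 0 < c) (hc1 : c ≤ 1) (hη : 0 < η)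
    (hK : 2 / c ≤ K) :
    ∀ᶠ n : ℕ in atTop, ⌈(n : ℝ) ^ (1 - c)⌉₊ ≤ ⌈(n : ℝ) ^ (c / 2)⌉₊ ^ K ∧
      (⌈(n : ℝ) ^ (c / 2)⌉₊ * ⌈(n : ℝ) ^ (1 - c)⌉₊ : ℝ) ≤ η * n := by
  have hlim : Tendsto (fun n : ℕ ↦ (n : ℝ) ^ (c / 2)) atTop atTop :=
    (tendsto_rpow_atTop (by positivity)).comp tendsto_natCast_atTop_atTop
  filter_upwards [hlim.eventually_ge_atTop (4 / η), eventually_ge_atTop 1] with n hlarge hn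
  have hn1 : (1 : ℝ) ≤ n := mod_cast hn
  have hn0 : (0 : ℝ) < n := by linarith
  have hceil {a : ℝ} (ha : 0 ≤ a) : (⌈(n : ℝ) ^ a⌉₊ : ℝ) ≤ 2 * (n : ℝ) ^ a := by
    linarith [Nat.ceil_lt_add_one (Real.rpow_nonneg hn0.le a), Real.one_le_rpow hn1 ha]
  constructor
  · refine Nat.ceil_le.mpr ?_
    calc (n : ℝ) ^ (1 - c) ≤ (n : ℝ) ^ (c / 2 * K) := by
          refine Real.rpow_le_rpow_of_exponent_le hn1 ?_
          linarith [(div_le_iff₀ hc0).mp hK]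
      _ = ((n : ℝ) ^ (c / 2)) ^ K := by rw [Real.rpow_mul hn0.le, Real.rpow_natCast]
      _ ≤ (⌈(n : ℝ) ^ (c / 2)⌉₊ : ℝ) ^ K := by gcongr; exact Nat.le_ceil _
      _ = (⌈(n : ℝ) ^ (c / 2)⌉₊ ^ K : ℕ) := by push_cast; rfl
  · calc (⌈(n : ℝ) ^ (c / 2)⌉₊ * ⌈(n : ℝ) ^ (1 - c)⌉₊ : ℝ)
        ≤ (2 * (n : ℝ) ^ (c / 2)) * (2 * (n : ℝ) ^ (1 - c)) := by
          gcongr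
          exacts [hceil (by linarith), hceil (by linarith)]
      _ = 4 * (n : ℝ) ^ (c / 2 + (1 - c)) := by rw [Real.rpow_add hn0]; ring
      _ ≤ η * (n : ℝ) ^ (c / 2) * (n : ℝ) ^ (c / 2 + (1 - c)) := by
          gcongr
          exact (div_le_iff₀' hη).mp hlarge
      _ = η * n := by
          rw [mul_assoc, ← Real.rpow_add hn0, show c / 2 + (c / 2 + (1 - c)) = 1 by ring,
            Real.rpow_one]

lemma isPurePair_of_anticompleteTo_compl {A B : Finset V} (hAB : Disjoint A B)
    (h : Gᶜ.AnticompleteTo A B) : G.IsPurePair A B := by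
  refine ⟨hAB, .inl fun a ha b hb ↦ ?_⟩
  by_contra hadj
  exact h a ha b hb ((G.compl_adj a b).mpr ⟨Finset.disjoint_iff_ne.mp hAB a ha b hb, hadj⟩)

theorem IsBerge.eventually_exists_isPurePair (hc0 : 0 < c) (hc1 : c ≤ 1) :
    ∀ᶠ n : ℕ in atTop, ∀ (V : Type u) [Fintype V] (G : SimpleGraph V), Fintype.card V = n →
      IsBerge G → ∃ A B : Finset V, G.IsPurePair A B ∧
        (n : ℝ) ^ (1 - c) ≤ A.card ∧ (n : ℝ) ^ (1 - c) ≤ B.card := by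
  obtain ⟨K, hK⟩ := exists_nat_ge (2 / c)
  have hK1 : 1 ≤ K := Nat.one_le_cast.mp
    (((one_le_div₀ hc0).mpr (by linarith)).trans hK : (1 : ℝ) ≤ K)
  let ε : ℝ := 1 / (5 * (2 * (K * (K + 1) + 1) + 3) * (K + 1))
  have hε : 5 * (2 * (K * (K + 1) + 1) + 3) * (K + 1) * ε ≤ 1 := by
    rw [mul_one_div_cancel (by positivity)]
  obtain ⟨δ, hδ, hRodl⟩ := exists_sparseTo_or_sparseTo_compl.{u} (cycleGraph 5) (ε := ε)
    (by positivity) (div_le_one_of_le₀ (mod_cast Nat.succ_le_of_lt (by positivity)) (by positivity))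
  filter_upwards [eventually_ceil_rpow_le_pow_and_mul_le hc0 hc1 (η := ε * δ) (by positivity) hK,
    eventually_ge_atTop 1] with n ⟨hmD, hDm⟩ hn V _ G hcard ⟨hG, hGc⟩
  have hceil (a : ℝ) : 1 ≤ ⌈(n : ℝ) ^ a⌉₊ := Nat.one_le_ceil_iff.mpr (by positivity)
  obtain ⟨W, -, hW, hsparse⟩ := hRodl V G (hG 5 (by decide) (by decide)) Finset.univ
  rw [Finset.card_univ, hcard] at hW
  have hDmW := hDm.trans ((mul_assoc ε δ n).trans_le (mul_le_mul_of_nonneg_left hW (by positivity)))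
  rcases hsparse with hsparse | hsparse
  · obtain ⟨A, B, hAB, hA, hB, hanti⟩ :=
      hG.exists_anticompleteTo_of_sparseTo hsparse (hceil _) (hceil _) hK1 hmD hε hDmW
    exact ⟨A, B, ⟨hAB, .inr hanti⟩, Nat.ceil_le.mp hA, Nat.ceil_le.mp hB⟩
  · obtain ⟨A, B, hAB, hA, hB, hanti⟩ :=
      hGc.exists_anticompleteTo_of_sparseTo hsparse (hceil _) (hceil _) hK1 hmD hε hDmW
    exact ⟨A, B, isPurePair_of_anticompleteTo_compl hAB hanti,
      Nat.ceil_le.mp hA, Nat.ceil_le.mp hB⟩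

lemma exists_tendsto_zero_eventually {P : ℕ → ℝ → Prop}
    (hP : ∀ c : ℝ, 0 < c → ∀ᶠ n in atTop, P n c) :
    ∃ δ : ℕ → ℝ, Tendsto δ atTop (𝓝 0) ∧ ∀ᶠ n in atTop, P n (δ n) := by
  classical
  choose N hN using fun j : ℕ ↦ eventually_atTop.mp (hP (1 / ((j : ℝ) + 1)) Nat.one_div_pos_of_nat)
  let j (n : ℕ) : ℕ := Nat.findGreatest (fun j ↦ N j ≤ n) n
  refine ⟨fun n ↦ 1 / ((j n : ℝ) + 1),
    tendsto_one_div_add_atTop_nhds_zero_nat.comp (tendsto_atTop.mpr fun J ↦ ?_), ?_⟩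
  · filter_upwards [eventually_ge_atTop J, eventually_ge_atTop (N J)] with n hJ hNJ
    exact Nat.le_findGreatest hJ hNJ
  · filter_upwards [eventually_ge_atTop (N 0)] with n hn
    exact hN _ _ (Nat.findGreatest_spec (P := fun j ↦ N j ≤ n) n.zero_le hn)

end PurePairs

end PerfectGraph

theorem mainTheorem5 :
    (∀ c : ℝ, 0 < c → ∃ N : ℕ, ∀ n : ℕ, N ≤ n →
      ∀ (V : Type u) [Fintype V] (G : SimpleGraph V), Fintype.card V = n → G.IsPerfect →
        ∃ A B : Finset V, G.IsPurePair A B ∧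
          (n : ℝ) ^ (1 - c) ≤ (A.card : ℝ) ∧ (n : ℝ) ^ (1 - c) ≤ (B.card : ℝ)) ∧
    (∃ δ : ℕ → ℝ, Tendsto δ atTop (𝓝 0) ∧ ∃ N : ℕ, ∀ n : ℕ, N ≤ n →
      ∀ (V : Type u) [Fintype V] (G : SimpleGraph V), Fintype.card V = n → G.IsPerfect →
        ∃ A B : Finset V, G.IsPurePair A B ∧
          (n : ℝ) ^ (1 - δ n) ≤ (A.card : ℝ) ∧ (n : ℝ) ^ (1 - δ n) ≤ (B.card : ℝ)) := by
  have hpairs (c : ℝ) (hc : 0 < c) : ∀ᶠ n : ℕ in atTop,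
      ∀ (V : Type u) [Fintype V] (G : SimpleGraph V), Fintype.card V = n → G.IsPerfect →
        ∃ A B : Finset V, G.IsPurePair A B ∧
          (n : ℝ) ^ (1 - c) ≤ (A.card : ℝ) ∧ (n : ℝ) ^ (1 - c) ≤ (B.card : ℝ) := by
    filter_upwards [PerfectGraph.IsBerge.eventually_exists_isPurePair.{u} (lt_min hc one_pos)
      (min_le_right c 1), eventually_ge_atTop 1] with n hBerge hn V _ G hcard hG
    obtain ⟨A, B, hAB, hA, hB⟩ := hBerge V G hcard (PerfectGraph.isBerge_of_isPerfect hG)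
    have hle : (n : ℝ) ^ (1 - c) ≤ (n : ℝ) ^ (1 - min c 1) :=
      Real.rpow_le_rpow_of_exponent_le (mod_cast hn) (by linarith [min_le_left c 1])
    exact ⟨A, B, hAB, hle.trans hA, hle.trans hB⟩
  simpa only [eventually_atTop] using
    And.intro hpairs (PerfectGraph.exists_tendsto_zero_eventually hpairs)
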